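/- Work in hyperbolic 3-space $\mathbb{H}^3$. A polyhedron is an intersection of finitely many closed half-spaces of $\mathbb{H}^3$ with nonempty interior and finite volume; its faces are its 2-dimensional faces, two distinct faces are adjacent if they share an edge, and a face is a $k$-gon if it has exactly $k$ edges. A polyhedron is ideal if all its vertices lie on $\partial\mathbb{H}^3$, and it is $\pi/3$-equiangular if the dihedral angle at every edge equals $\pi/3$. For every integer $n\ge 1$ there is an ideal $\pi/3$-equiangular polyhedron $P_n$ in $\mathbb{H}^3$ with exactly $(n^2+n+6)/2$ faces and exactly $n^2+n+2$ vertices, all of them ideal, and with the following combinatorial structure. (1) There is an ideal vertex $v_0$ that is shared by exactly three faces $A_1,A_2,A_3$; these are pairwise adjacent, and each of them is an $(n+2)$-gon. (2) With indices mod 3, for each $i$ there is exactly one face $B_i$, other than $A_{i+2}$, that is adjacent to both $A_i$ and $A_{i+1}$. If $n\ge 2$, then $B_1,B_2,B_3$ are three distinct quadrilaterals; if $n=1$, then $B_1=B_2=B_3$ is a triangle (so $P_1$ is a tetrahedron). (3) Every face other than the $A_i$ and $B_i$ that is adjacent to at least one of $A_1,A_2,A_3$ is adjacent to exactly one of them and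 is a pentagon. If $n\ge 2$, there are exactly $3(n-2)$ such faces. (4) Every face other than the $A_i$ that is adjacent to none of $A_1,A_2,A_3$ is a hexagon. If $n\ge 2$, there are exactly $(n-3)(n-2)/2$ such faces. Consequently there are infinitely many $\pi/3$-equiangular polyhedra in $\mathbb{H}^3$, even up to isometry. -/

import Mathlib

namespace Hyp

open MeasureTheory

noncomputable section

/-- The Lorentzian inner product on `ℝ^{1,3}`. -/
def lor (x y : Fin 4 → ℝ) : ℝ :=
  -(x 0 * y 0) + x 1 * y 1 + x 2 * y 2 + x 3 * y 3

/-- Hyperbolic 3-space: the upper sheet of the hyperboloid `⟨x, x⟩ = -1` in `ℝ^{1,3}`. -/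
def H3 : Type := {x : Fin 4 → ℝ // lor x x = -1 ∧ 0 < x 0}

/-- The topology of `H3`: the one induced from `ℝ⁴` (it is also the one of the hyperbolic metric). -/
instance : TopologicalSpace H3 :=
  inferInstanceAs (TopologicalSpace {x : Fin 4 → ℝ // lor x x = -1 ∧ 0 < x 0})

/-- The hyperbolic distance: `cosh d(x, y) = -⟨x, y⟩`. -/
def hdist (x y : H3) : ℝ := Real.arcosh (-lor x.1 y.1)

/-- Two subsets of `H3` are congruent if an isometry of `H3` maps one onto the other. -/
def Congruent (P Q : Set H3) : Prop :=
  ∃ f : H3 ≃ H3, (∀ x y, hdist (f x) (f y) = hdist x y) ∧ f '' P = Q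

/-- Congruence as an equivalence relation; its classes are the isometry classes of subsets. -/
def congruence : Setoid (Set H3) where
  r := Congruent
  iseqv :=
    { refl := fun P => ⟨Equiv.refl H3, fun _ _ => rfl, by simp⟩
      symm := by
        rintro P Q ⟨f, hf, rfl⟩
        refine ⟨f.symm, fun x y => ?_, by simp⟩
        simpa using (hf (f.symm x) (f.symm y)).symm
      trans := by
        rintro P Q R ⟨f, hf, rfl⟩ ⟨g, hg, rfl⟩
        refine ⟨f.trans g, fun x y => ?_, ?_⟩
        · simp [hf, hg]
        · simp [Set.image_image] }

/-- Radial projection of the hyperboloid onto the open unit ball of `ℝ³` (the projective, or Klein,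
model). The boundary at infinity of `H3` is the unit sphere of this `ℝ³`. -/
def klein (x : H3) : EuclideanSpace ℝ (Fin 3) :=
  WithLp.toLp 2 fun i => x.1 i.succ / x.1 0

/-- Hyperbolic volume, whose density in the projective model is `(1 - |y|²)⁻²`. -/
def hvol (P : Set H3) : ENNReal :=
  ∫⁻ y in klein '' P, ENNReal.ofReal (1 / (1 - ‖y‖ ^ 2) ^ 2)

/-- The closed half-spaces of `H3` are the sets `{x | ⟨x, e⟩ ≤ 0}` with `⟨e, e⟩ = 1`; the vector `e`
is the unit normal of the bounding plane `{x | ⟨x, e⟩ = 0}` pointing out of the half-space.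
A (convex) polyhedron is an intersection of finitely many closed half-spaces which has interior
points and finite volume. -/
def IsPolyhedron (P : Set H3) : Prop :=
  (∃ S : Set (Fin 4 → ℝ), S.Finite ∧ (∀ e ∈ S, lor e e = 1) ∧
    P = {x : H3 | ∀ e ∈ S, lor x.1 e ≤ 0}) ∧
  (interior P).Nonempty ∧ hvol P < ⊤

/-- `e` is the outer unit normal of a plane that supports `P` exactly along `F`. -/
def IsOuterNormal (P F : Set H3) (e : Fin 4 → ℝ) : Prop :=
  lor e e = 1 ∧ (∀ x ∈ P, lor x.1 e ≤ 0) ∧ F = {x | x ∈ P ∧ lor x.1 e = 0}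

/-- `F` is a `k`-dimensional face of `P`: the part of `P` on a supporting plane, of dimension `k`.
(A convex subset of `H3` has dimension `k` iff its linear span in `ℝ⁴` has dimension `k + 1`.) -/
def IsFace (P : Set H3) (k : ℕ) (F : Set H3) : Prop :=
  (∃ e, IsOuterNormal P F e) ∧
  Module.finrank ℝ (Submodule.span ℝ ((fun x : H3 => x.1) '' F)) = k + 1

/-- The 2-dimensional faces. -/
def faces (P : Set H3) : Set (Set H3) := {F | IsFace P 2 F}

/-- Two distinct 2-dimensional faces are adjacent if they share an edge. -/
def Adjacent (P F G : Set H3) : Prop :=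
  F ∈ faces P ∧ G ∈ faces P ∧ F ≠ G ∧ IsFace P 1 (F ∩ G)

/-- The 2-dimensional face `F` of `P` is a `k`-gon, i.e. it has exactly `k` edges. -/
def IsGon (P : Set H3) (k : ℕ) (F : Set H3) : Prop :=
  F ∈ faces P ∧ {E | IsFace P 1 E ∧ E ⊆ F}.encard = k

/-- The points at infinity of `P`: the points of the unit sphere in the closure of `P` in the
closed ball. -/
def pointsAtInfinity (P : Set H3) : Set (EuclideanSpace ℝ (Fin 3)) :=
  Metric.sphere 0 1 ∩ closure (klein '' P)

/-- The ideal vertices of a polyhedron. Since polyhedra have finite volume, these are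
all its points at infinity. -/
def idealVertices (P : Set H3) : Set (EuclideanSpace ℝ (Fin 3)) := pointsAtInfinity P

/-- A polyhedron is ideal if it has no vertices in `H3`. -/
def IsIdealPolyhedron (P : Set H3) : Prop :=
  IsPolyhedron P ∧ ∀ x : H3, ¬ IsFace P 0 {x}

/-- A polyhedron all of whose dihedral angles equal `θ`. The dihedral angle at the common edge of
two adjacent faces is `π` minus the angle between their outer unit normals; these normals are
tangent to `H3` along the edge, where `lor` is the Riemannian inner product. -/
def IsEquiangular (θ : ℝ) (P : Set H3) : Prop :=
  IsPolyhedron P ∧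
  ∀ F G, Adjacent P F G → ∀ e f, IsOuterNormal P F e → IsOuterNormal P G f →
    Real.pi - Real.arccos (lor e f) = θ

/-- The combinatorial structure of `P_n`, `n ≥ 1`. Indices in `Fin 3` are read cyclically. -/
def HasStructure (n : ℕ) (P : Set H3) : Prop :=
  ∃ v₀ ∈ idealVertices P, ∃ A B : Fin 3 → Set H3,
    -- exactly three faces `A i` share `v₀`; they are pairwise adjacent `(n+2)`-gons
    Function.Injective A ∧
    {F | F ∈ faces P ∧ v₀ ∈ pointsAtInfinity F} = Set.range A ∧
    (∀ i j, i ≠ j → Adjacent P (A i) (A j)) ∧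
    (∀ i, IsGon P (n + 2) (A i)) ∧
    -- `B i` is the face adjacent to `A i` and `A (i+1)` other than `A (i+2)`
    (∀ i, {F | Adjacent P F (A i) ∧ Adjacent P F (A (i + 1)) ∧ F ≠ A (i + 2)} = {B i}) ∧
    -- for `n = 1` the `B i` are one triangle, for `n ≥ 2` three quadrilaterals
    (n = 1 → ∀ i, B i = B 0 ∧ IsGon P 3 (B i)) ∧
    (2 ≤ n → Function.Injective B ∧ ∀ i, IsGon P 4 (B i)) ∧
    -- the other faces adjacent to some `A i` are adjacent to just one of them and are pentagons
    (∀ F ∈ faces P, F ∉ Set.range A → F ∉ Set.range B → (∃ i, Adjacent P F (A i)) →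
      (∃! i, Adjacent P F (A i)) ∧ IsGon P 5 F) ∧
    -- the remaining faces are hexagons
    (∀ F ∈ faces P, F ∉ Set.range A → (∀ i, ¬ Adjacent P F (A i)) → IsGon P 6 F) ∧
    -- the numbers of these pentagons and hexagons
    (2 ≤ n →
      {F | F ∈ faces P ∧ F ∉ Set.range A ∧ F ∉ Set.range B ∧
        ∃ i, Adjacent P F (A i)}.encard = (3 * (n - 2) : ℕ) ∧
      {F | F ∈ faces P ∧ F ∉ Set.range A ∧
        ∀ i, ¬ Adjacent P F (A i)}.encard = ((n - 3) * (n - 2) / 2 : ℕ))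

end

end Hyp

/-!
In the upper half-space model put `v₀` at infinity. Tile the boundary plane by a regular honeycomb
and cut out of it an equilateral triangle whose sides run along short diagonals of hexagons, so that
a side cuts off one vertex of each hexagon that it crosses. If a side crosses `n` hexagons, the
centres of the `n (n + 1) / 2` hexagons meeting the interior of the triangle are indexed by the
triples `g` of natural numbers with sum `m = n - 1`. The polyhedron is bounded by the vertical
planes over the three sides and the hemispheres over the circles circumscribed about these hexagons.
Two such circles meet at the angle that makes the dihedral angle `π / 3` exactly when the hexagons
are neighbours, and the ideal vertices other than `v₀` are the vertices of the honeycomb in the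
triangle. The face over `g` has one edge for each neighbouring hexagon and one for each side that
crosses its hexagon, i.e. for each zero coordinate of `g`; it is a hexagon in the interior of the
triangle, a pentagon along the sides and a quadrilateral in the corners.
-/

namespace Hyp

open MeasureTheory

noncomputable section

/-! ### The Lorentz product -/

lemma lor_comm (x y : Fin 4 → ℝ) : lor x y = lor y x := by unfold lor; ring

lemma lor_add_left (x y z : Fin 4 → ℝ) : lor (x + y) z = lor x z + lor y z := by
  simp only [lor, Pi.add_apply]; ring

lemma lor_add_right (x y z : Fin 4 → ℝ) : lor x (y + z) = lor x y + lor x z := by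
  simp only [lor, Pi.add_apply]; ring

lemma lor_smul_left (c : ℝ) (x y : Fin 4 → ℝ) : lor (c • x) y = c * lor x y := by
  simp only [lor, Pi.smul_apply, smul_eq_mul]; ring

lemma lor_smul_right (c : ℝ) (x y : Fin 4 → ℝ) : lor x (c • y) = c * lor x y := by
  simp only [lor, Pi.smul_apply, smul_eq_mul]; ring

/-- The Lorentz product as a bilinear form. -/
def lorForm : LinearMap.BilinForm ℝ (Fin 4 → ℝ) :=
  LinearMap.mk₂ ℝ lor lor_add_left lor_smul_left lor_add_right lor_smul_right

@[simp] lemma lorForm_apply (x y : Fin 4 → ℝ) : lorForm x y = lor x y := rfl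

lemma lor_sub_left (x y z : Fin 4 → ℝ) : lor (x - y) z = lor x z - lor y z :=
  lorForm.map_sub₂ x y z

lemma lor_sub_right (x y z : Fin 4 → ℝ) : lor x (y - z) = lor x y - lor x z :=
  (lorForm x).map_sub y z

lemma lor_sum_left {ι : Type*} (s : Finset ι) (c : ι → ℝ) (w : ι → Fin 4 → ℝ) (y : Fin 4 → ℝ) :
    lor (∑ j ∈ s, c j • w j) y = ∑ j ∈ s, c j * lor (w j) y := by
  simp only [← lorForm_apply, map_sum, LinearMap.sum_apply, map_smul, LinearMap.smul_apply,
    smul_eq_mul]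

lemma continuous_lor_left (y : Fin 4 → ℝ) : Continuous fun x => lor x y := by
  unfold lor; fun_prop

lemma eq_zero_of_lor_eq_zero {ι : Type*} {v : ι → Fin 4 → ℝ}
    (hv : Submodule.span ℝ (Set.range v) = ⊤) {x : Fin 4 → ℝ} (h : ∀ i, lor x (v i) = 0) :
    x = 0 := by
  have hx : lorForm x = 0 := LinearMap.ext_on_range hv h
  have hlor (i : Fin 4) : lor x (Pi.single i 1) = 0 := LinearMap.congr_fun hx _
  ext i
  have := hlor i
  fin_cases i <;> simpa [lor] using this

lemma sq_lor_add_mul_le (x y : Fin 4 → ℝ) :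
    (lor x y + x 0 * y 0) ^ 2 ≤ (lor x x + x 0 ^ 2) * (lor y y + y 0 ^ 2) := by
  have cauchySchwarz := Finset.sum_mul_sq_le_sq_mul_sq Finset.univ
    (fun i : Fin 3 => x i.succ) (fun i => y i.succ)
  have dot (a b) : lor a b + a 0 * b 0 = a 1 * b 1 + a 2 * b 2 + a 3 * b 3 := by unfold lor; ring
  simpa only [sq, dot, Fin.sum_univ_three, Fin.succ_zero_eq_one, Fin.succ_one_eq_two,
    show (Fin.succ 2 : Fin 4) = 3 from rfl] using cauchySchwarz

lemma lor_self_pos_of_orthogonal {t x : Fin 4 → ℝ} (ht : lor t t < 0) (h : lor x t = 0)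
    (hx : x ≠ 0) : 0 < lor x x := by
  by_contra! hxx
  have cauchySchwarz := sq_lor_add_mul_le x t
  have spatial (y) : lor y y + y 0 ^ 2 = y 1 ^ 2 + y 2 ^ 2 + y 3 ^ 2 := by unfold lor; ring
  have htime : 0 ≤ lor t t + t 0 ^ 2 := by rw [spatial]; positivity
  have hx0 : x 0 = 0 := by
    rw [h, zero_add, mul_pow] at cauchySchwarz
    have := mul_le_mul_of_nonneg_right (add_le_of_nonpos_left hxx : _ ≤ x 0 ^ 2) htime
    exact pow_eq_zero_iff two_ne_zero |>.1 (le_antisymm (by nlinarith) (sq_nonneg _))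
  have hsum : x 1 ^ 2 + x 2 ^ 2 + x 3 ^ 2 ≤ 0 := by simpa [← spatial, hx0] using hxx
  have hx1 : x 1 = 0 := by nlinarith [sq_nonneg (x 2), sq_nonneg (x 3)]
  have hx2 : x 2 = 0 := by nlinarith [sq_nonneg (x 1), sq_nonneg (x 3)]
  have hx3 : x 3 = 0 := by nlinarith [sq_nonneg (x 1), sq_nonneg (x 2)]
  refine hx (funext fun i => ?_)
  fin_cases i <;> assumption

lemma eq_of_orthogonal_of_one_le {t e f : Fin 4 → ℝ} (ht : lor t t < 0) (he : lor e e = 1)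
    (hf : lor f f = 1) (het : lor e t = 0) (hft : lor f t = 0) (h : 1 ≤ lor e f) : e = f := by
  by_contra hne
  have := lor_self_pos_of_orthogonal ht (by rw [lor_sub_left, het, hft, sub_zero])
    (sub_ne_zero.2 hne)
  rw [lor_sub_left, lor_sub_right, lor_sub_right, he, hf, lor_comm f e] at this
  linarith

section LightLike

variable {u v w : Fin 4 → ℝ}

lemma linearIndependent_pair_of_lightLike (hu : lor u u = 0) (hv : lor v v = 0)
    (huv : lor u v ≠ 0) : LinearIndependent ℝ ![u, v] := by
  rw [LinearIndependent.pair_iff]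
  intro a b h
  have pair (y) : a * lor u y + b * lor v y = 0 := by
    rw [← lor_smul_left, ← lor_smul_left, ← lor_add_left, h]; simp [lor]
  have hpu := pair u
  have hpv := pair v
  simp only [hu, hv, lor_comm v u, mul_zero, zero_add, add_zero, mul_eq_zero, huv, or_false]
    at hpu hpv
  exact ⟨hpv, hpu⟩

/-- The Gram matrix of three light-like vectors has determinant `2⟨u, v⟩⟨u, w⟩⟨v, w⟩`. -/
lemma linearIndependent_triple_of_lightLike (hu : lor u u = 0) (hv : lor v v = 0)
    (hw : lor w w = 0) (huv : lor u v ≠ 0) (huw : lor u w ≠ 0) (hvw : lor v w ≠ 0) :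
    LinearIndependent ℝ ![u, v, w] := by
  rw [Fintype.linearIndependent_iff]
  intro g h
  simp only [Fin.sum_univ_three, Matrix.cons_val_zero, Matrix.cons_val_one, Matrix.cons_val] at h
  have pair (y) : g 0 * lor u y + g 1 * lor v y + g 2 * lor w y = 0 := by
    rw [← lor_smul_left, ← lor_smul_left, ← lor_smul_left, ← lor_add_left, ← lor_add_left, h]
    simp [lor]
  have hpu : g 1 * lor u v + g 2 * lor u w = 0 := by
    have := pair u; rw [hu, lor_comm v u, lor_comm w u] at this; linarith
  have hpv : g 0 * lor u v + g 2 * lor v w = 0 := by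
    have := pair v; rw [hv, lor_comm w v] at this; linarith
  have hpw : g 0 * lor u w + g 1 * lor v w = 0 := by
    have := pair w; rw [hw] at this; linarith
  have h2 : g 2 = 0 := by
    have : 2 * lor u w * lor v w * g 2 = 0 := by
      linear_combination lor v w * hpu + lor u w * hpv - lor u v * hpw
    simpa [huw, hvw] using this
  have h1 : g 1 = 0 := by simpa [h2, huv] using hpu
  have h0 : g 0 = 0 := by simpa [h2, huv] using hpv
  intro i
  fin_cases i <;> assumption

end LightLike

/-! ### Points and isometries of hyperbolic space -/

lemma exists_H3_eq_smul {x : Fin 4 → ℝ} (hx : lor x x < 0) (h0 : 0 < x 0) :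
    ∃ p : H3, ∃ c : ℝ, 0 < c ∧ p.1 = c • x := by
  have hs : 0 < √(-lor x x) := Real.sqrt_pos.2 (neg_pos.2 hx)
  have hs2 : √(-lor x x) ^ 2 = -lor x x := Real.sq_sqrt (neg_pos.2 hx).le
  refine ⟨⟨(√(-lor x x))⁻¹ • x, ?_, mul_pos (inv_pos.2 hs) h0⟩, _, inv_pos.2 hs, rfl⟩
  rw [lor_smul_left, lor_smul_right]
  field_simp
  linarith

/-- The projective chart `x ↦ (x₁, x₂, x₃) / x₀`, of which `klein` is the restriction to `H3`; on
light-like vectors it gives the points at infinity. Its value is junk (zero) where `x 0 = 0`. -/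
def radial (x : Fin 4 → ℝ) : EuclideanSpace ℝ (Fin 3) := WithLp.toLp 2 fun i => x i.succ / x 0

lemma klein_eq_radial (x : H3) : klein x = radial x.1 := rfl

lemma radial_smul {c : ℝ} (hc : c ≠ 0) (x : Fin 4 → ℝ) : radial (c • x) = radial x := by
  ext i
  simp [radial, mul_div_mul_left _ _ hc]

lemma norm_radial_sq {x : Fin 4 → ℝ} (h : x 0 ≠ 0) :
    ‖radial x‖ ^ 2 = 1 + lor x x / x 0 ^ 2 := by
  simp only [EuclideanSpace.norm_sq_eq, radial, Fin.sum_univ_three, Real.norm_eq_abs, sq_abs, lor,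
    Fin.succ_zero_eq_one, Fin.succ_one_eq_two, show (Fin.succ 2 : Fin 4) = 3 from rfl]
  field_simp
  ring

lemma norm_klein_lt_one (x : H3) : ‖klein x‖ < 1 := by
  have h := norm_radial_sq x.2.2.ne'
  rw [x.2.1] at h
  have : -1 / x.1 0 ^ 2 < 0 := div_neg_of_neg_of_pos (by norm_num) (pow_pos x.2.2 2)
  rw [klein_eq_radial, ← sq_lt_one_iff₀ (norm_nonneg _)]
  linarith

lemma one_le_neg_lor (x y : H3) : 1 ≤ -lor x.1 y.1 := by
  have one_le (z : H3) : 1 ≤ z.1 0 := by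
    have := z.2.1
    simp only [lor] at this
    nlinarith [z.2.2, sq_nonneg (z.1 1), sq_nonneg (z.1 2), sq_nonneg (z.1 3)]
  have hsq : (lor x.1 y.1 + x.1 0 * y.1 0) ^ 2 ≤ (x.1 0 * y.1 0 - 1) ^ 2 := by
    have := sq_lor_add_mul_le x.1 y.1
    rw [x.2.1, y.2.1] at this
    nlinarith [sq_nonneg (x.1 0 - y.1 0)]
  have := abs_le_of_sq_le_sq hsq (by nlinarith [one_le x, one_le y])
  linarith [(abs_le.1 this).2]

lemma lor_eq_of_hdist_eq {x y x' y' : H3} (h : hdist x y = hdist x' y') :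
    lor x.1 y.1 = lor x'.1 y'.1 :=
  neg_injective (Real.arcosh_injOn (one_le_neg_lor x y) (one_le_neg_lor x' y') h)

lemma span_range_H3 : Submodule.span ℝ (Set.range fun p : H3 => p.1) = ⊤ := by
  set S := Submodule.span ℝ (Set.range fun p : H3 => p.1)
  have mem_of_timelike {x : Fin 4 → ℝ} (hx : lor x x < 0) (h0 : 0 < x 0) : x ∈ S := by
    obtain ⟨p, c, hc, hp⟩ := exists_H3_eq_smul hx h0
    rw [← S.smul_mem_iff hc.ne', ← hp]
    exact Submodule.subset_span ⟨p, rfl⟩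
  have he : (Pi.single 0 1 : Fin 4 → ℝ) ∈ S := mem_of_timelike (by simp [lor]) (by simp)
  refine eq_top_iff.2 fun x _ => ?_
  obtain ⟨t, ht⟩ := exists_gt (|x 0| + x 1 ^ 2 + x 2 ^ 2 + x 3 ^ 2 + 1)
  have hlow := neg_abs_le (x 0)
  have hxt : x + t • Pi.single 0 1 ∈ S := by
    apply mem_of_timelike
    · simp [lor]
      nlinarith [sq_nonneg (x 1), sq_nonneg (x 2), sq_nonneg (x 3)]
    · simp
      nlinarith [sq_nonneg (x 1), sq_nonneg (x 2), sq_nonneg (x 3)]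
  simpa using S.sub_mem hxt (S.smul_mem t he)

lemma exists_linearEquiv_of_gram_eq {ι : Type*} {u v : ι → Fin 4 → ℝ}
    (hu : Submodule.span ℝ (Set.range u) = ⊤) (hv : Submodule.span ℝ (Set.range v) = ⊤)
    (h : ∀ i j, lor (u i) (u j) = lor (v i) (v j)) :
    ∃ L : (Fin 4 → ℝ) ≃ₗ[ℝ] (Fin 4 → ℝ),
      (∀ x y, lor (L x) (L y) = lor x y) ∧ ∀ i, L (u i) = v i := by
  let φ := Finsupp.linearCombination ℝ u
  let ψ := Finsupp.linearCombination ℝ v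
  have hφ : Function.Surjective φ := by
    rw [← LinearMap.range_eq_top, Finsupp.range_linearCombination, hu]
  have hψ : Function.Surjective ψ := by
    rw [← LinearMap.range_eq_top, Finsupp.range_linearCombination, hv]
  have gram (c d) : lor (φ c) (φ d) = lor (ψ c) (ψ d) := by
    have : lorForm.compl₁₂ φ φ = lorForm.compl₁₂ ψ ψ := by ext i j; simpa [φ, ψ] using h i j
    exact LinearMap.congr_fun₂ this c d
  have hker : LinearMap.ker φ = LinearMap.ker ψ := by
    ext c
    simp only [LinearMap.mem_ker]
    constructor <;> intro hc
    · refine eq_zero_of_lor_eq_zero hv fun i => ?_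
      have := gram c (Finsupp.single i 1)
      rw [hc] at this
      simpa [ψ, lor] using this.symm
    · refine eq_zero_of_lor_eq_zero hu fun i => ?_
      have := gram c (Finsupp.single i 1)
      rw [hc] at this
      simpa [φ, lor] using this
  let L := (φ.quotKerEquivOfSurjective hφ).symm.trans
    ((Submodule.quotEquivOfEq _ _ hker).trans (ψ.quotKerEquivOfSurjective hψ))
  have hL (c) : L (φ c) = ψ c := by
    have : (φ.quotKerEquivOfSurjective hφ).symm (φ c) = Submodule.Quotient.mk c :=
      (LinearEquiv.symm_apply_eq _).2 rfl
    simp only [L, LinearEquiv.trans_apply, this]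
    rfl
  refine ⟨L, fun x y => ?_, fun i => ?_⟩
  · obtain ⟨c, rfl⟩ := hφ x
    obtain ⟨d, rfl⟩ := hφ y
    rw [hL, hL, gram]
  · simpa [φ, ψ] using hL (Finsupp.single i 1)

lemma exists_linearEquiv_of_isometry (f : H3 ≃ H3) (hf : ∀ x y, hdist (f x) (f y) = hdist x y) :
    ∃ L : (Fin 4 → ℝ) ≃ₗ[ℝ] (Fin 4 → ℝ), (∀ x y, lor (L x) (L y) = lor x y) ∧
      ∀ x : H3, L x.1 = (f x).1 := by
  refine exists_linearEquiv_of_gram_eq span_range_H3 ?_ fun x y =>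
    (lor_eq_of_hdist_eq (hf x y)).symm
  change Submodule.span ℝ (Set.range ((fun p : H3 => p.1) ∘ f)) = ⊤
  rw [f.surjective.range_comp, span_range_H3]

lemma isFace_image {P F : Set H3} {k : ℕ} (f : H3 ≃ H3)
    (hf : ∀ x y, hdist (f x) (f y) = hdist x y) (h : IsFace P k F) :
    IsFace (f '' P) k (f '' F) := by
  obtain ⟨L, hL, hfL⟩ := exists_linearEquiv_of_isometry f hf
  obtain ⟨⟨e, he, hle, hF⟩, hk⟩ := h
  refine ⟨⟨L e, by rw [hL, he], ?_, ?_⟩, ?_⟩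
  · rintro _ ⟨x, hx, rfl⟩
    rw [← hfL, hL]
    exact hle x hx
  · ext y
    obtain ⟨x, rfl⟩ := f.surjective y
    simp only [f.injective.mem_set_image, Set.mem_ofPred_eq, hF, ← hfL, hL]
  · have himage : (fun x : H3 => x.1) '' (f '' F) =
        (L : (Fin 4 → ℝ) →ₗ[ℝ] (Fin 4 → ℝ)) '' ((fun x : H3 => x.1) '' F) := by
      rw [Set.image_image, Set.image_image]
      exact Set.image_congr fun x _ => (hfL x).symm
    rw [himage, ← Submodule.map_span, LinearEquiv.finrank_map_eq, hk]

lemma Congruent.encard_faces_eq {P Q : Set H3} (h : Congruent P Q) :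
    (faces P).encard = (faces Q).encard := by
  have encard_le {P Q : Set H3} : Congruent P Q → (faces P).encard ≤ (faces Q).encard := by
    rintro ⟨f, hf, rfl⟩
    exact Set.encard_le_encard_of_injOn (fun F hF => isFace_image f hf hF)
      f.injective.image_injective.injOn
  exact le_antisymm (encard_le h) (encard_le (congruence.iseqv.symm h))

/-! ### Cones spanned by light-like vectors -/

/-- A polyhedral cone in `ℝ^{1,3}`, described both by its unit outer normals `normal i` and by its
light-like generators `gen j`, such that any two walls either enclose the angle `π / 3` along an
edge or do not meet in `H3`. Its points on the hyperboloid form an ideal `π / 3`-equiangular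
polyhedron. -/
structure IdealCone (I J : Type*) [Fintype J] where
  normal : I → Fin 4 → ℝ
  gen : J → Fin 4 → ℝ
  center : Fin 4 → ℝ
  lor_normal_self : ∀ i, lor (normal i) (normal i) = 1
  lor_gen_self : ∀ j, lor (gen j) (gen j) = 0
  gen_zero_pos : ∀ j, 0 < gen j 0
  lor_gen_gen_neg : ∀ j k, j ≠ k → lor (gen j) (gen k) < 0
  lor_gen_normal_nonpos : ∀ j i, lor (gen j) (normal i) ≤ 0
  exists_combination : ∀ x, (∀ i, lor x (normal i) ≤ 0) →
    ∃ c : J → ℝ, (∀ j, 0 ≤ c j) ∧ x = ∑ j, c j • gen j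
  lor_center_self_neg : lor center center < 0
  center_zero_pos : 0 < center 0
  lor_center_normal_neg : ∀ i, lor center (normal i) < 0
  two_lt_ncard : ∀ i, 2 < {j | lor (gen j) (normal i) = 0}.ncard
  lor_normal_normal : ∀ i i', i ≠ i' → lor (normal i) (normal i') ≤ -1 ∨
    (lor (normal i) (normal i') = -1 / 2 ∧
      {j | lor (gen j) (normal i) = 0 ∧ lor (gen j) (normal i') = 0}.Nontrivial)

namespace IdealCone

variable {I J : Type*} [Fintype J] (C : IdealCone I J)

/-- The polyhedron cut out by the cone. -/
def poly : Set H3 := {x | ∀ i, lor x.1 (C.normal i) ≤ 0}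

/-- The part of the polyhedron on the `i`-th wall. -/
def face (i : I) : Set H3 := {x | x ∈ C.poly ∧ lor x.1 (C.normal i) = 0}

/-- The points of `H3` in the cone spanned by the generators with indices in `K`. -/
def hull (K : Set J) : Set H3 :=
  {x | ∃ c : J → ℝ, (∀ j, 0 ≤ c j) ∧ (∀ j ∉ K, c j = 0) ∧ x.1 = ∑ j, c j • C.gen j}

/-- The indices of the generators in the hyperplane orthogonal to `e`. -/
def gensOn (e : Fin 4 → ℝ) : Set J := {j | lor (C.gen j) e = 0}

/-- The walls that enclose the angle `π / 3` with the `i`-th wall. -/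
def neighbours (i : I) : Set I := {i' | lor (C.normal i) (C.normal i') = -1 / 2}

lemma lor_pair_neg {j k : J} (h : j ≠ k) {s : ℝ} (hs : 0 < s) :
    lor (C.gen j + s • C.gen k) (C.gen j + s • C.gen k) < 0 := by
  have := mul_neg_of_pos_of_neg hs (C.lor_gen_gen_neg j k h)
  simp only [lor_add_left, lor_add_right, lor_smul_left, lor_smul_right, C.lor_gen_self,
    lor_comm (C.gen k) (C.gen j)]
  linarith

lemma lor_add_gen_neg {j k : J} (h : j ≠ k) :
    lor (C.gen j + C.gen k) (C.gen j + C.gen k) < 0 := by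
  simpa using C.lor_pair_neg h one_pos

lemma exists_mem_hull_pair {K : Set J} {j k : J} (h : j ≠ k) (hj : j ∈ K) (hk : k ∈ K) {s : ℝ}
    (hs : 0 < s) : ∃ x ∈ C.hull K, ∃ c : ℝ, 0 < c ∧ x.1 = c • (C.gen j + s • C.gen k) := by
  classical
  have h0 : 0 < (C.gen j + s • C.gen k) 0 :=
    add_pos (C.gen_zero_pos j) (mul_pos hs (C.gen_zero_pos k))
  obtain ⟨x, c, hc, hx⟩ := exists_H3_eq_smul (C.lor_pair_neg h hs) h0
  refine ⟨x, ⟨c • (Pi.single j 1 + Pi.single k s), fun l => ?_, fun l hl => ?_, ?_⟩, c, hc, hx⟩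
  · have : 0 ≤ (Pi.single j 1 + Pi.single k s : J → ℝ) :=
      add_nonneg (Pi.single_nonneg.2 zero_le_one) (Pi.single_nonneg.2 hs.le)
    exact mul_nonneg hc.le (this l)
  · have hlj : l ≠ j := fun h => hl (h ▸ hj)
    have hlk : l ≠ k := fun h => hl (h ▸ hk)
    simp [hlj, hlk]
  · simp only [hx, Pi.smul_apply, Pi.add_apply, Pi.single_apply, smul_eq_mul, mul_smul, add_smul,
      ← Finset.smul_sum, Finset.sum_add_distrib, ite_smul, one_smul, zero_smul, Finset.sum_ite_eq',
      Finset.mem_univ, if_true]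

lemma lor_sum_gen_self {K : Set J} (hK : K.Subsingleton) {c : J → ℝ} (hc : ∀ j ∉ K, c j = 0) :
    lor (∑ j, c j • C.gen j) (∑ j, c j • C.gen j) = 0 := by
  rw [lor_sum_left]
  refine Finset.sum_eq_zero fun j _ => ?_
  by_cases hj : j ∈ K
  · rw [lor_comm, lor_sum_left, Finset.sum_eq_zero, mul_zero]
    intro k _
    by_cases hk : k ∈ K
    · rw [hK hk hj, C.lor_gen_self, mul_zero]
    · rw [hc k hk, zero_mul]
  · rw [hc j hj, zero_mul]

lemma hull_eq_empty {K : Set J} (hK : K.Subsingleton) : C.hull K = ∅ := by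
  refine Set.eq_empty_of_forall_notMem ?_
  rintro x ⟨c, -, hc, hx⟩
  have := x.2.1
  rw [hx, C.lor_sum_gen_self hK hc] at this
  norm_num at this

include C in
lemma nontrivial_gens : Nontrivial J := by
  by_contra hJ
  obtain ⟨c, -, hc⟩ := C.exists_combination C.center fun i => (C.lor_center_normal_neg i).le
  have hK : (Set.univ : Set J).Subsingleton := by
    rwa [← Set.not_nontrivial_iff, Set.nontrivial_univ_iff]
  have := C.lor_center_self_neg
  rw [hc, C.lor_sum_gen_self hK fun j hj => (hj (Set.mem_univ j)).elim] at this
  exact this.false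

lemma hull_subset_poly (K : Set J) : C.hull K ⊆ C.poly := by
  rintro x ⟨c, hc, -, hx⟩ i
  rw [hx, lor_sum_left]
  exact Finset.sum_nonpos fun j _ =>
    mul_nonpos_of_nonneg_of_nonpos (hc j) (C.lor_gen_normal_nonpos j i)

/-! ### Spans of hulls -/

/-- The linear span of `F` in `ℝ⁴`, whose dimension `IsFace` refers to. -/
abbrev linSpan (F : Set H3) : Submodule ℝ (Fin 4 → ℝ) :=
  Submodule.span ℝ ((fun x : H3 => x.1) '' F)

lemma linSpan_hull_le (K : Set J) : linSpan (C.hull K) ≤ Submodule.span ℝ (C.gen '' K) := by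
  rw [Submodule.span_le]
  rintro _ ⟨x, ⟨c, -, hc, hx⟩, rfl⟩
  simp only [hx]
  refine Submodule.sum_mem _ fun j _ => ?_
  by_cases hj : j ∈ K
  · exact Submodule.smul_mem _ _ (Submodule.subset_span ⟨j, hj, rfl⟩)
  · rw [hc j hj, zero_smul]; exact Submodule.zero_mem _

lemma gen_mem_linSpan_hull {K : Set J} (hK : K.Nontrivial) {j : J} (hj : j ∈ K) :
    C.gen j ∈ linSpan (C.hull K) := by
  obtain ⟨k, hk, hkj⟩ := hK.exists_ne j
  have pair_mem {s : ℝ} (hs : 0 < s) : C.gen j + s • C.gen k ∈ linSpan (C.hull K) := by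
    obtain ⟨x, hx, c, hc, hxc⟩ := C.exists_mem_hull_pair hkj.symm hj hk hs
    rw [← Submodule.smul_mem_iff _ hc.ne', ← hxc]
    exact Submodule.subset_span ⟨x, hx, rfl⟩
  convert Submodule.sub_mem _ (Submodule.smul_mem _ 2 (pair_mem one_pos)) (pair_mem two_pos)
    using 1
  module

lemma finrank_linSpan_hull_le (K : Set J) : Module.finrank ℝ (linSpan (C.hull K)) ≤ K.ncard := by
  classical
  calc Module.finrank ℝ (linSpan (C.hull K))
      ≤ Module.finrank ℝ (Submodule.span ℝ (C.gen '' K)) :=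
        Submodule.finrank_mono (C.linSpan_hull_le K)
    _ ≤ (C.gen '' K).ncard := by
        rw [Set.ncard_eq_toFinset_card' (C.gen '' K)]
        exact finrank_span_le_card _
    _ ≤ K.ncard := Set.ncard_image_le K.toFinite

lemma le_finrank_linSpan_hull {K : Set J} (hK : K.Nontrivial) {m : ℕ} {v : Fin m → Fin 4 → ℝ}
    (hv : ∀ i, v i ∈ C.gen '' K) (hind : LinearIndependent ℝ v) :
    m ≤ Module.finrank ℝ (linSpan (C.hull K)) := by
  have hcard := finrank_span_eq_card hind
  rw [Fintype.card_fin] at hcard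
  refine hcard.symm.le.trans (Submodule.finrank_mono (Submodule.span_le.2 ?_))
  rintro _ ⟨i, rfl⟩
  obtain ⟨j, hj, hji⟩ := hv i
  exact hji ▸ C.gen_mem_linSpan_hull hK hj

lemma linearIndependent_three_gens {j k l : J} (hjk : j ≠ k) (hjl : j ≠ l) (hkl : k ≠ l) :
    LinearIndependent ℝ ![C.gen j, C.gen k, C.gen l] :=
  linearIndependent_triple_of_lightLike (C.lor_gen_self j) (C.lor_gen_self k) (C.lor_gen_self l)
    (C.lor_gen_gen_neg j k hjk).ne (C.lor_gen_gen_neg j l hjl).ne (C.lor_gen_gen_neg k l hkl).ne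

lemma two_le_finrank_linSpan_hull {K : Set J} (hK : K.Nontrivial) :
    2 ≤ Module.finrank ℝ (linSpan (C.hull K)) := by
  obtain ⟨j, hj, k, hk, hjk⟩ := hK
  refine C.le_finrank_linSpan_hull ⟨j, hj, k, hk, hjk⟩ (v := ![C.gen j, C.gen k]) ?_
    (linearIndependent_pair_of_lightLike (C.lor_gen_self j) (C.lor_gen_self k)
      (C.lor_gen_gen_neg j k hjk).ne)
  intro i
  fin_cases i
  exacts [⟨j, hj, rfl⟩, ⟨k, hk, rfl⟩]

lemma three_le_finrank_linSpan_hull {K : Set J} (hK : 2 < K.ncard) :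
    3 ≤ Module.finrank ℝ (linSpan (C.hull K)) := by
  obtain ⟨j, k, l, hj, hk, hl, hjk, hjl, hkl⟩ := (Set.two_lt_ncard_iff K.toFinite).1 hK
  refine C.le_finrank_linSpan_hull ⟨j, hj, k, hk, hjk⟩ (v := ![C.gen j, C.gen k, C.gen l]) ?_
    (C.linearIndependent_three_gens hjk hjl hkl)
  intro i
  fin_cases i
  exacts [⟨j, hj, rfl⟩, ⟨k, hk, rfl⟩, ⟨l, hl, rfl⟩]

lemma ncard_eq_two_of_finrank {K : Set J} (h : Module.finrank ℝ (linSpan (C.hull K)) = 2) :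
    K.ncard = 2 := by
  refine le_antisymm (not_lt.1 fun hK => ?_) (h ▸ C.finrank_linSpan_hull_le K)
  have := C.three_le_finrank_linSpan_hull hK
  omega

/-! ### Supporting planes -/

lemma eq_of_two_lt_ncard {e f : Fin 4 → ℝ} (he : lor e e = 1) (hf : lor f f = 1)
    (hce : lor C.center e < 0) (hcf : lor C.center f < 0)
    (h : 2 < (C.gensOn e ∩ C.gensOn f).ncard) : e = f := by
  obtain ⟨j, k, l, ⟨hje, hjf⟩, ⟨hke, hkf⟩, ⟨hle, hlf⟩, hjk, hjl, hkl⟩ :=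
    (Set.two_lt_ncard_iff (Set.toFinite _)).1 h
  simp only [gensOn, Set.mem_ofPred_eq, lor_comm _ e, lor_comm _ f] at hje hke hle hjf hkf hlf
  have hind : LinearIndependent ℝ ![e, C.gen j, C.gen k, C.gen l] := by
    refine linearIndependent_finCons.2 ⟨C.linearIndependent_three_gens hjk hjl hkl, fun hmem => ?_⟩
    have hker : Submodule.span ℝ (Set.range ![C.gen j, C.gen k, C.gen l]) ≤
        LinearMap.ker (lorForm e) := by
      rw [Submodule.span_le]
      rintro _ ⟨i, rfl⟩
      fin_cases i <;> assumption
    have hee : lor e e = 0 := hker hmem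
    linarith
  have hfe : f = lor f e • e := by
    refine sub_eq_zero.1 (eq_zero_of_lor_eq_zero
      (hind.span_eq_top_of_card_eq_finrank' (by simp)) fun i => ?_)
    rw [lor_sub_left, lor_smul_left]
    fin_cases i <;> simp [*]
  have hsq : lor f e * lor f e = 1 := by
    rw [hfe, lor_smul_left, lor_smul_right, he] at hf
    linarith
  rcases mul_self_eq_one_iff.1 hsq with h1 | h1
  · rw [hfe, h1, one_smul]
  · rw [hfe, h1, lor_smul_right] at hcf
    linarith

lemma normal_gensOn_injective : Function.Injective fun i => C.gensOn (C.normal i) := by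
  intro i i' h
  have hcard : 2 < (C.gensOn (C.normal i) ∩ C.gensOn (C.normal i')).ncard := by
    rw [show C.gensOn (C.normal i) = C.gensOn (C.normal i') from h, Set.inter_self]
    exact C.two_lt_ncard i'
  have heq := C.eq_of_two_lt_ncard (C.lor_normal_self i) (C.lor_normal_self i')
    (C.lor_center_normal_neg i) (C.lor_center_normal_neg i') hcard
  have hself := C.lor_normal_self i'
  by_contra hne
  rcases C.lor_normal_normal i i' hne with h' | ⟨h', -⟩ <;> rw [heq] at h' <;> linarith

include C in
lemma finite_walls : Finite I := Finite.of_injective _ C.normal_gensOn_injective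

section Supporting

variable {e : Fin 4 → ℝ}

lemma lor_nonpos_of_cone (he : ∀ j, lor (C.gen j) e ≤ 0) {x : Fin 4 → ℝ}
    (hx : ∀ i, lor x (C.normal i) ≤ 0) : lor x e ≤ 0 := by
  obtain ⟨c, hc, rfl⟩ := C.exists_combination x hx
  rw [lor_sum_left]
  exact Finset.sum_nonpos fun j _ => mul_nonpos_of_nonneg_of_nonpos (hc j) (he j)

lemma forall_poly_lor_nonpos_iff :
    (∀ x ∈ C.poly, lor x.1 e ≤ 0) ↔ ∀ j, lor (C.gen j) e ≤ 0 := by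
  refine ⟨fun he j => ?_, fun he x hx => C.lor_nonpos_of_cone he hx⟩
  have := C.nontrivial_gens
  obtain ⟨k, hkj⟩ := exists_ne j
  have segment_nonpos {s : ℝ} (hs : 0 < s) : lor (C.gen j) e + s * lor (C.gen k) e ≤ 0 := by
    obtain ⟨x, hx, c, hc, hxc⟩ :=
      C.exists_mem_hull_pair hkj.symm (Set.mem_univ j) (Set.mem_univ k) hs
    have hxe := he x (C.hull_subset_poly _ hx)
    rw [hxc, lor_smul_left, lor_add_left, lor_smul_left] at hxe
    exact nonpos_of_mul_nonpos_right hxe hc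
  have hcont : Continuous fun s : ℝ => lor (C.gen j) e + s * lor (C.gen k) e := by fun_prop
  have hlim := (hcont.tendsto 0).mono_left (nhdsWithin_le_nhds (s := Set.Ioi 0))
  rw [zero_mul, add_zero] at hlim
  exact le_of_tendsto hlim (Filter.eventually_of_mem self_mem_nhdsWithin fun s => segment_nonpos)

lemma poly_inter_eq_hull (he : ∀ j, lor (C.gen j) e ≤ 0) :
    {x | x ∈ C.poly ∧ lor x.1 e = 0} = C.hull (C.gensOn e) := by
  ext x
  constructor
  · rintro ⟨hx, hxe⟩
    obtain ⟨c, hc, hxc⟩ := C.exists_combination x.1 hx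
    refine ⟨c, hc, fun j hj => ?_, hxc⟩
    rw [hxc, lor_sum_left, Finset.sum_eq_zero_iff_of_nonpos fun j _ =>
      mul_nonpos_of_nonneg_of_nonpos (hc j) (he j)] at hxe
    exact (mul_eq_zero.1 (hxe j (Finset.mem_univ j))).resolve_right hj
  · intro hx
    refine ⟨C.hull_subset_poly _ hx, ?_⟩
    obtain ⟨c, -, hc, hxc⟩ := hx
    rw [hxc, lor_sum_left]
    refine Finset.sum_eq_zero fun j _ => ?_
    by_cases hj : j ∈ C.gensOn e
    · rw [show lor (C.gen j) e = 0 from hj, mul_zero]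
    · rw [hc j hj, zero_mul]

lemma subset_gensOn_of_hull (he : ∀ j, lor (C.gen j) e ≤ 0) {K : Set J} (hK : K.Nontrivial)
    (h : ∀ x ∈ C.hull K, lor x.1 e = 0) : K ⊆ C.gensOn e := by
  intro j hj
  obtain ⟨k, hk, hkj⟩ := hK.exists_ne j
  obtain ⟨x, hx, c, hc, hxc⟩ := C.exists_mem_hull_pair hkj.symm hj hk one_pos
  have hxe := h x hx
  rw [hxc, lor_smul_left, mul_eq_zero, or_iff_right hc.ne', one_smul, lor_add_left] at hxe
  exact le_antisymm (he j) (by linarith [he k])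

lemma exists_normal_pos_of_lor_pos (he : ∀ j, lor (C.gen j) e ≤ 0) {x y : Fin 4 → ℝ}
    (hx : ∀ i, lor x (C.normal i) ≤ 0) (hxe : lor x e = 0) (hy : 0 < lor y e) :
    ∃ i, lor x (C.normal i) = 0 ∧ 0 < lor y (C.normal i) := by
  have := C.finite_walls
  by_contra! hno
  have stays_in_cone : ∀ᶠ s : ℝ in nhdsWithin 0 (Set.Ioi 0),
      ∀ i, lor (x + s • y) (C.normal i) ≤ 0 := by
    rw [Filter.eventually_all]
    intro i
    simp only [lor_add_left, lor_smul_left]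
    rcases (hx i).lt_or_eq with hlt | heq
    · have hcont : Continuous fun s : ℝ => lor x (C.normal i) + s * lor y (C.normal i) := by
        fun_prop
      have hlt' := (hcont.tendsto 0).eventually_lt_const (by simpa using hlt)
      exact (hlt'.filter_mono nhdsWithin_le_nhds).mono fun s hs => hs.le
    · filter_upwards [self_mem_nhdsWithin] with s hs
      rw [heq, zero_add]
      exact mul_nonpos_of_nonneg_of_nonpos (le_of_lt hs) (hno i heq)
  obtain ⟨s, hs, hs0⟩ := (stays_in_cone.and self_mem_nhdsWithin).exists
  have hle := C.lor_nonpos_of_cone he hs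
  rw [lor_add_left, lor_smul_left, hxe, zero_add] at hle
  exact hle.not_gt (mul_pos hs0 hy)

lemma lor_center_neg (h1 : lor e e = 1) (he : ∀ j, lor (C.gen j) e ≤ 0) :
    lor C.center e < 0 := by
  have hcone (i) : lor C.center (C.normal i) ≤ 0 := (C.lor_center_normal_neg i).le
  refine lt_of_le_of_ne (C.lor_nonpos_of_cone he hcone) fun h => ?_
  obtain ⟨i, hi, -⟩ := C.exists_normal_pos_of_lor_pos he hcone h (h1.symm ▸ one_pos)
  exact (C.lor_center_normal_neg i).ne hi

lemma exists_gensOn_subset_gensOn_normal (he : ∀ j, lor (C.gen j) e ≤ 0) {y : Fin 4 → ℝ}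
    (hy : 0 < lor y e) : ∃ i, C.gensOn e ⊆ C.gensOn (C.normal i) ∧ 0 < lor y (C.normal i) := by
  classical
  have lor_sum (f : Fin 4 → ℝ) : lor (∑ j ∈ (C.gensOn e).toFinset, C.gen j) f =
      ∑ j ∈ (C.gensOn e).toFinset, lor (C.gen j) f := by
    simpa only [one_smul, one_mul] using
      lor_sum_left (C.gensOn e).toFinset (fun _ => 1) C.gen f
  obtain ⟨i, hi, hyi⟩ := C.exists_normal_pos_of_lor_pos he
    (x := ∑ j ∈ (C.gensOn e).toFinset, C.gen j)
    (fun i => (lor_sum _).trans_le (Finset.sum_nonpos fun j _ => C.lor_gen_normal_nonpos j i))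
    ((lor_sum e).trans (Finset.sum_eq_zero fun j hj =>
      (Set.mem_toFinset.1 hj : j ∈ C.gensOn e))) hy
  rw [lor_sum, Finset.sum_eq_zero_iff_of_nonpos fun j _ => C.lor_gen_normal_nonpos j i] at hi
  exact ⟨i, fun j hj => hi j (Set.mem_toFinset.2 hj), hyi⟩

end Supporting

/-! ### Faces -/

lemma poly_lor_normal_nonpos (i : I) : ∀ x ∈ C.poly, lor x.1 (C.normal i) ≤ 0 := fun _ hx => hx i

lemma face_eq_hull (i : I) : C.face i = C.hull (C.gensOn (C.normal i)) :=
  C.poly_inter_eq_hull fun j => C.lor_gen_normal_nonpos j i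

lemma nontrivial_gensOn_normal (i : I) : (C.gensOn (C.normal i)).Nontrivial :=
  Set.one_lt_ncard_iff_nontrivial.1 (one_lt_two.trans (C.two_lt_ncard i))

lemma isOuterNormal_normal (i : I) : IsOuterNormal C.poly (C.face i) (C.normal i) :=
  ⟨C.lor_normal_self i, C.poly_lor_normal_nonpos i, rfl⟩

lemma eq_normal_of_isOuterNormal {i : I} {e : Fin 4 → ℝ} (h : IsOuterNormal C.poly (C.face i) e) :
    e = C.normal i := by
  obtain ⟨he, hpoly, hface⟩ := h
  have hgen := C.forall_poly_lor_nonpos_iff.1 hpoly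
  have hsub : C.gensOn (C.normal i) ⊆ C.gensOn e := by
    refine C.subset_gensOn_of_hull hgen (C.nontrivial_gensOn_normal i) fun x hx => ?_
    rw [← C.face_eq_hull, hface] at hx
    exact hx.2
  refine C.eq_of_two_lt_ncard he (C.lor_normal_self i) (C.lor_center_neg he hgen)
    (C.lor_center_normal_neg i) ?_
  rw [Set.inter_eq_right.2 hsub]
  exact C.two_lt_ncard i

lemma normal_injective : Function.Injective C.normal := fun i i' h =>
  C.normal_gensOn_injective (by simp only [h])

lemma face_injective : Function.Injective C.face := by
  intro i i' h
  have hi := C.isOuterNormal_normal i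
  rw [h] at hi
  exact C.normal_injective (C.eq_normal_of_isOuterNormal hi)

lemma finrank_linSpan_face (i : I) : Module.finrank ℝ (linSpan (C.face i)) = 3 := by
  apply le_antisymm
  · have hle : linSpan (C.face i) ≤ LinearMap.ker (lorForm (C.normal i)) := by
      rw [Submodule.span_le]
      rintro _ ⟨x, hx, rfl⟩
      exact (lor_comm _ _).trans hx.2
    have hne : lorForm (C.normal i) ≠ 0 := by
      intro h
      have h0 : lor (C.normal i) (C.normal i) = 0 := LinearMap.congr_fun h _
      exact one_ne_zero ((C.lor_normal_self i).symm.trans h0)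
    have hker := Module.Dual.finrank_ker_add_one_of_ne_zero hne
    rw [Module.finrank_fin_fun] at hker
    exact (Submodule.finrank_mono hle).trans (by omega)
  · rw [C.face_eq_hull]
    exact C.three_le_finrank_linSpan_hull (C.two_lt_ncard i)

lemma isFace_two_iff {F : Set H3} : IsFace C.poly 2 F ↔ ∃ i, C.face i = F := by
  constructor
  · rintro ⟨⟨e, he, hpoly, rfl⟩, hrank⟩
    have hgen := C.forall_poly_lor_nonpos_iff.1 hpoly
    rw [C.poly_inter_eq_hull hgen] at hrank ⊢
    have hcard : 2 < (C.gensOn e).ncard := hrank.symm.trans_le (C.finrank_linSpan_hull_le _)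
    obtain ⟨i, hsub, -⟩ := C.exists_gensOn_subset_gensOn_normal hgen (y := e) (he.symm ▸ one_pos)
    have heq : C.normal i = e := C.eq_of_two_lt_ncard (C.lor_normal_self i) he
      (C.lor_center_normal_neg i) (C.lor_center_neg he hgen)
      (by rwa [Set.inter_eq_right.2 hsub])
    exact ⟨i, by rw [C.face_eq_hull, heq]⟩
  · rintro ⟨i, rfl⟩
    exact ⟨⟨_, C.isOuterNormal_normal i⟩, C.finrank_linSpan_face i⟩

lemma faces_poly : faces C.poly = Set.range C.face := Set.ext fun _ => C.isFace_two_iff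

/-! ### Edges and adjacency -/

lemma face_inter_face (i i' : I) :
    C.face i ∩ C.face i' = {x | x ∈ C.poly ∧ lor x.1 (C.normal i + C.normal i') = 0} := by
  ext x
  simp only [face, Set.mem_inter_iff, Set.mem_ofPred_eq, lor_add_right]
  constructor
  · rintro ⟨⟨hx, hi⟩, -, hi'⟩
    exact ⟨hx, by rw [hi, hi', add_zero]⟩
  · rintro ⟨hx, hsum⟩
    have := hx i
    have := hx i'
    exact ⟨⟨hx, by linarith⟩, hx, by linarith⟩

lemma lor_gen_add_normal_nonpos (i i' : I) (j : J) :
    lor (C.gen j) (C.normal i + C.normal i') ≤ 0 := by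
  rw [lor_add_right]
  exact add_nonpos (C.lor_gen_normal_nonpos j i) (C.lor_gen_normal_nonpos j i')

lemma gensOn_add_normal (i i' : I) : C.gensOn (C.normal i + C.normal i') =
    C.gensOn (C.normal i) ∩ C.gensOn (C.normal i') := by
  ext j
  have hi := C.lor_gen_normal_nonpos j i
  have hi' := C.lor_gen_normal_nonpos j i'
  simp only [gensOn, Set.mem_inter_iff, Set.mem_ofPred_eq, lor_add_right]
  constructor
  · intro h
    constructor <;> linarith
  · rintro ⟨h, h'⟩
    rw [h, h', add_zero]

lemma face_inter_eq_hull (i i' : I) :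
    C.face i ∩ C.face i' = C.hull (C.gensOn (C.normal i) ∩ C.gensOn (C.normal i')) := by
  rw [face_inter_face, C.poly_inter_eq_hull (C.lor_gen_add_normal_nonpos i i'), gensOn_add_normal]

/-- If the product of the normals were at most `-1` along an edge, they would be opposite, since the
orthogonal complement of a point of the edge is positive definite. -/
lemma mem_neighbours_iff {i i' : I} : i' ∈ C.neighbours i ↔
    i ≠ i' ∧ (C.gensOn (C.normal i) ∩ C.gensOn (C.normal i')).Nontrivial := by
  constructor
  · intro (h : lor (C.normal i) (C.normal i') = -1 / 2)
    have hne : i ≠ i' := by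
      rintro rfl
      linarith [C.lor_normal_self i]
    exact ⟨hne, ((C.lor_normal_normal i i' hne).resolve_left (by rw [h]; norm_num)).2⟩
  · rintro ⟨hne, j, ⟨hji, hji'⟩, k, ⟨hki, hki'⟩, hjk⟩
    refine ((C.lor_normal_normal i i' hne).resolve_left fun hle => ?_).1
    simp only [gensOn, Set.mem_ofPred_eq, lor_comm (C.gen _)] at hji hji' hki hki'
    have hopp : C.normal i = (-1 : ℝ) • C.normal i' := by
      refine eq_of_orthogonal_of_one_le (C.lor_add_gen_neg hjk) (C.lor_normal_self i) ?_ ?_ ?_ ?_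
      · rw [lor_smul_left, lor_smul_right, C.lor_normal_self]; norm_num
      · rw [lor_add_right, hji, hki, add_zero]
      · rw [lor_smul_left, lor_add_right, hji', hki', add_zero, mul_zero]
      · rw [lor_smul_right]; linarith
    have hi := C.lor_center_normal_neg i
    rw [hopp, lor_smul_right] at hi
    linarith [C.lor_center_normal_neg i']

lemma ncard_gensOn_inter {i i' : I} (h : i' ∈ C.neighbours i) :
    (C.gensOn (C.normal i) ∩ C.gensOn (C.normal i')).ncard = 2 := by
  obtain ⟨hne, hK⟩ := C.mem_neighbours_iff.1 h
  refine le_antisymm (not_lt.1 fun hcard => hne ?_) (Set.one_lt_ncard_iff_nontrivial.2 hK)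
  exact C.normal_injective (C.eq_of_two_lt_ncard (C.lor_normal_self i) (C.lor_normal_self i')
    (C.lor_center_normal_neg i) (C.lor_center_normal_neg i') hcard)

/-- Three unit vectors with pairwise products `-1/2` that are orthogonal to a timelike vector have
a sum of length zero. -/
lemma subsingleton_gensOn_inter_inter {i₁ i₂ i₃ : I} (h₁₂ : i₁ ≠ i₂) (h₁₃ : i₁ ≠ i₃)
    (h₂₃ : i₂ ≠ i₃) : (C.gensOn (C.normal i₁) ∩ C.gensOn (C.normal i₂) ∩
      C.gensOn (C.normal i₃)).Subsingleton := by
  rw [← Set.not_nontrivial_iff]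
  intro hK
  have h12 := C.mem_neighbours_iff.2 ⟨h₁₂, hK.mono fun j hj => ⟨hj.1.1, hj.1.2⟩⟩
  have h13 := C.mem_neighbours_iff.2 ⟨h₁₃, hK.mono fun j hj => ⟨hj.1.1, hj.2⟩⟩
  have h23 := C.mem_neighbours_iff.2 ⟨h₂₃, hK.mono fun j hj => ⟨hj.1.2, hj.2⟩⟩
  obtain ⟨j, ⟨⟨hj1, hj2⟩, hj3⟩, k, ⟨⟨hk1, hk2⟩, hk3⟩, hjk⟩ := hK
  simp only [neighbours, gensOn, Set.mem_ofPred_eq] at *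
  have hsum : C.normal i₁ + C.normal i₂ + C.normal i₃ = 0 := by
    by_contra hne
    have hpos := lor_self_pos_of_orthogonal (C.lor_add_gen_neg hjk) ?_ hne
    · simp only [lor_add_left, lor_add_right, C.lor_normal_self,
        lor_comm (C.normal i₂) (C.normal i₁), lor_comm (C.normal i₃), h12, h13, h23] at hpos
      norm_num at hpos
    · rw [lor_comm]
      simp only [lor_add_left, lor_add_right, hj1, hj2, hj3, hk1, hk2, hk3, add_zero]
  have hcenter : lor C.center (C.normal i₁ + C.normal i₂ + C.normal i₃) < 0 := by
    rw [lor_add_right, lor_add_right]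
    linarith [C.lor_center_normal_neg i₁, C.lor_center_normal_neg i₂, C.lor_center_normal_neg i₃]
  rw [hsum] at hcenter
  exact hcenter.ne ((lorForm C.center).map_zero)

lemma isFace_one_inter {i i' : I} (h : i' ∈ C.neighbours i) :
    IsFace C.poly 1 (C.face i ∩ C.face i') := by
  refine ⟨⟨C.normal i + C.normal i', ?_, ?_, C.face_inter_face i i'⟩, ?_⟩
  · rw [lor_add_left, lor_add_right, lor_add_right, C.lor_normal_self, C.lor_normal_self,
      lor_comm (C.normal i'), show lor (C.normal i) (C.normal i') = -1 / 2 from h]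
    norm_num
  · exact C.forall_poly_lor_nonpos_iff.2 (C.lor_gen_add_normal_nonpos i i')
  · rw [C.face_inter_eq_hull]
    exact le_antisymm ((C.finrank_linSpan_hull_le _).trans_eq (C.ncard_gensOn_inter h))
      (C.two_le_finrank_linSpan_hull (C.mem_neighbours_iff.1 h).2)

lemma exists_neighbour_gensOn_subset {e : Fin 4 → ℝ} (he : lor e e = 1)
    (hgen : ∀ j, lor (C.gen j) e ≤ 0) (hcard : (C.gensOn e).ncard = 2) {i : I}
    (hi : C.gensOn e ⊆ C.gensOn (C.normal i)) :
    ∃ i' ∈ C.neighbours i, C.gensOn e ⊆ C.gensOn (C.normal i') := by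
  have hK : (C.gensOn e).Nontrivial := Set.one_lt_ncard_iff_nontrivial.1 (hcard ▸ one_lt_two)
  have hlt : lor e (C.normal i) < 1 := by
    by_contra! hle
    obtain ⟨j, hj, k, hk, hjk⟩ := hK
    have orthogonal {f : Fin 4 → ℝ} (hf : C.gensOn e ⊆ C.gensOn f) :
        lor f (C.gen j + C.gen k) = 0 := by
      rw [lor_comm, lor_add_left, show lor (C.gen j) f = 0 from hf hj,
        show lor (C.gen k) f = 0 from hf hk, add_zero]
    have heq := eq_of_orthogonal_of_one_le (C.lor_add_gen_neg hjk) he (C.lor_normal_self i)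
      (orthogonal subset_rfl) (orthogonal hi) hle
    have := C.two_lt_ncard i
    rw [← heq] at this
    exact this.ne' hcard
  obtain ⟨i', hi', hpos⟩ := C.exists_gensOn_subset_gensOn_normal hgen (y := e - C.normal i)
    (by rw [lor_sub_left, he, lor_comm]; linarith)
  have hne : i ≠ i' := by
    rintro rfl
    rw [lor_sub_left, C.lor_normal_self] at hpos
    linarith
  exact ⟨i', C.mem_neighbours_iff.2 ⟨hne, hK.mono (Set.subset_inter hi hi')⟩, hi'⟩

lemma exists_neighbour_of_isFace_one {E : Set H3} (hE : IsFace C.poly 1 E) {i : I}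
    (hi : E ⊆ C.face i) : ∃ i' ∈ C.neighbours i, E = C.face i ∩ C.face i' := by
  obtain ⟨⟨e, he, hpoly, rfl⟩, hrank⟩ := hE
  have hgen := C.forall_poly_lor_nonpos_iff.1 hpoly
  rw [C.poly_inter_eq_hull hgen] at hrank hi ⊢
  have hcard := C.ncard_eq_two_of_finrank hrank
  have hsub := C.subset_gensOn_of_hull (fun j => C.lor_gen_normal_nonpos j i)
    (Set.one_lt_ncard_iff_nontrivial.1 (hcard ▸ one_lt_two)) fun x hx => (hi hx).2
  obtain ⟨i', hi', hsub'⟩ := C.exists_neighbour_gensOn_subset he hgen hcard hsub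
  refine ⟨i', hi', ?_⟩
  rw [C.face_inter_eq_hull, Set.eq_of_subset_of_ncard_le (Set.subset_inter hsub hsub')
    (by rw [hcard, C.ncard_gensOn_inter hi'])]

lemma face_inter_injOn (i : I) :
    Set.InjOn (fun i' => C.face i ∩ C.face i') (C.neighbours i) := by
  intro i₁ h₁ i₂ h₂ (heq : C.face i ∩ C.face i₁ = C.face i ∩ C.face i₂)
  obtain ⟨hne₁, hK⟩ := C.mem_neighbours_iff.1 h₁
  have hsub := C.subset_gensOn_of_hull (fun j => C.lor_gen_normal_nonpos j i₂) hK fun x hx => by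
    rw [← C.face_inter_eq_hull, heq] at hx
    exact hx.2.2
  by_contra hne
  exact hK.not_subsingleton ((C.subsingleton_gensOn_inter_inter hne₁
    (C.mem_neighbours_iff.1 h₂).1 hne).anti (Set.subset_inter subset_rfl hsub))

lemma adjacent_iff {i i' : I} :
    Adjacent C.poly (C.face i) (C.face i') ↔ i' ∈ C.neighbours i := by
  constructor
  · rintro ⟨-, -, hne, -, hrank⟩
    rw [C.face_inter_eq_hull] at hrank
    exact C.mem_neighbours_iff.2 ⟨fun h => hne (h ▸ rfl), Set.one_lt_ncard_iff_nontrivial.1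
      (C.ncard_eq_two_of_finrank hrank ▸ one_lt_two)⟩
  · intro h
    exact ⟨C.isFace_two_iff.2 ⟨i, rfl⟩, C.isFace_two_iff.2 ⟨i', rfl⟩,
      C.face_injective.ne (C.mem_neighbours_iff.1 h).1, C.isFace_one_inter h⟩

lemma isGon_iff {i : I} {k : ℕ} :
    IsGon C.poly k (C.face i) ↔ (C.neighbours i).encard = k := by
  have hedges : {E | IsFace C.poly 1 E ∧ E ⊆ C.face i} =
      (fun i' => C.face i ∩ C.face i') '' C.neighbours i := by
    ext E
    constructor
    · rintro ⟨hE, hi⟩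
      obtain ⟨i', h, rfl⟩ := C.exists_neighbour_of_isFace_one hE hi
      exact ⟨i', h, rfl⟩
    · rintro ⟨i', h, rfl⟩
      exact ⟨C.isFace_one_inter h, Set.inter_subset_left⟩
  rw [IsGon, hedges, (C.face_inter_injOn i).encard_image]
  exact and_iff_right (C.isFace_two_iff.2 ⟨i, rfl⟩)

lemma not_isFace_zero (F : Set H3) : ¬ IsFace C.poly 0 F := by
  rintro ⟨⟨e, -, hpoly, rfl⟩, hrank⟩
  rw [C.poly_inter_eq_hull (C.forall_poly_lor_nonpos_iff.1 hpoly)] at hrank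
  rcases (C.gensOn e).subsingleton_or_nontrivial with hK | hK
  · rw [C.hull_eq_empty hK, Set.image_empty, Submodule.span_empty, finrank_bot] at hrank
    omega
  · exact absurd ((C.two_le_finrank_linSpan_hull hK).trans_eq hrank) (by norm_num)

/-! ### Points at infinity and volume -/

lemma interior_nonempty : (interior C.poly).Nonempty := by
  have := C.finite_walls
  obtain ⟨p, c, hc, hp⟩ := exists_H3_eq_smul C.lor_center_self_neg C.center_zero_pos
  have hopen : IsOpen (⋂ i, {x : H3 | lor x.1 (C.normal i) < 0}) :=
    isOpen_iInter_of_finite fun i => isOpen_lt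
      ((continuous_lor_left _).comp continuous_subtype_val) continuous_const
  refine ⟨p, mem_interior.2 ⟨_, fun x hx i => (Set.mem_iInter.1 hx i).le, hopen, ?_⟩⟩
  refine Set.mem_iInter.2 fun i => ?_
  rw [Set.mem_ofPred_eq, hp, lor_smul_left]
  exact mul_neg_of_pos_of_neg hc (C.lor_center_normal_neg i)

end IdealCone

lemma exists_pos_le_norm_sub {E J : Type*} [NormedAddCommGroup E] [Finite J] {p : J → E}
    (hp : Function.Injective p) : ∃ δ : ℝ, 0 < δ ∧ ∀ j k, j ≠ k → δ ≤ ‖p j - p k‖ := by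
  have h : ∀ᶠ δ : ℝ in nhdsWithin 0 (Set.Ioi 0), ∀ j k, j ≠ k → δ ≤ ‖p j - p k‖ := by
    simp only [Filter.eventually_all]
    intro j k hjk
    have hpos : 0 < ‖p j - p k‖ := norm_pos_iff.2 (sub_ne_zero.2 (hp.ne hjk))
    exact nhdsWithin_le_nhds (Iic_mem_nhds hpos)
  obtain ⟨δ, hδp, hδ⟩ := (h.and self_mem_nhdsWithin).exists
  exact ⟨δ, hδ, hδp⟩

section UnitSphere

variable {E J : Type*} [NormedAddCommGroup E] [InnerProductSpace ℝ E] [Fintype J] {p : J → E}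
  {c : J → ℝ}

lemma one_sub_norm_sq_eq_sum (hp : ∀ j, ‖p j‖ = 1) (hs : ∑ j, c j = 1) :
    1 - ‖∑ j, c j • p j‖ ^ 2 = ∑ k, c k * ‖∑ j, c j • p j - p k‖ ^ 2 := by
  set y := ∑ j, c j • p j with hy
  have expand (k : J) :
      c k * ‖y - p k‖ ^ 2 = c k * ‖y‖ ^ 2 - 2 * inner ℝ y (c k • p k) + c k := by
    rw [norm_sub_sq_real, hp, inner_smul_right]
    ring
  rw [Finset.sum_congr rfl fun k _ => expand k, Finset.sum_add_distrib, Finset.sum_sub_distrib,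
    ← Finset.mul_sum, ← inner_sum, ← hy, real_inner_self_eq_norm_sq, ← Finset.sum_mul, hs]
  ring

lemma norm_sum_sub_le [DecidableEq J] (hp : ∀ j, ‖p j‖ = 1) (hc : ∀ j, 0 ≤ c j)
    (hs : ∑ j, c j = 1) (j : J) :
    ‖∑ k, c k • p k - p j‖ ≤ 2 * ∑ k ∈ Finset.univ.erase j, c k := by
  have hdiff : ∑ k, c k • p k - p j = ∑ k ∈ Finset.univ.erase j, c k • (p k - p j) := by
    rw [Finset.sum_erase _ (by rw [sub_self, smul_zero])]
    simp only [smul_sub, Finset.sum_sub_distrib, ← Finset.sum_smul, hs, one_smul]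
  rw [hdiff, Finset.mul_sum]
  refine (norm_sum_le _ _).trans (Finset.sum_le_sum fun k _ => ?_)
  rw [norm_smul, Real.norm_of_nonneg (hc k), mul_comm]
  refine mul_le_mul_of_nonneg_right ((norm_sub_le _ _).trans ?_) (hc k)
  rw [hp, hp]
  norm_num

/-- A polytope inscribed in the unit sphere leaves the sphere at a linear rate at its vertices. -/
lemma exists_mul_norm_sub_le (hp : ∀ j, ‖p j‖ = 1) {δ : ℝ} (hδ : 0 < δ)
    (hδp : ∀ j k, j ≠ k → δ ≤ ‖p j - p k‖) (hc : ∀ j, 0 ≤ c j) (hs : ∑ j, c j = 1) :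
    ∃ j, δ ^ 2 / 8 * ‖∑ j, c j • p j - p j‖ ≤ 1 - ‖∑ j, c j • p j‖ ^ 2 := by
  classical
  obtain ⟨i, -, -⟩ := Finset.exists_ne_zero_of_sum_ne_zero (hs.trans_ne one_ne_zero)
  have : Nonempty J := ⟨i⟩
  rw [one_sub_norm_sq_eq_sum hp hs]
  set y := ∑ j, c j • p j
  obtain ⟨j, nearest⟩ := Finite.exists_min fun j => ‖y - p j‖
  have far {k : J} (hk : k ≠ j) : δ / 2 ≤ ‖y - p k‖ := by
    have := (hδp k j hk).trans (norm_sub_le_norm_sub_add_norm_sub (p k) y (p j))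
    rw [norm_sub_rev (p k)] at this
    linarith [nearest k]
  refine ⟨j, ?_⟩
  calc δ ^ 2 / 8 * ‖y - p j‖ ≤ δ ^ 2 / 8 * (2 * ∑ k ∈ Finset.univ.erase j, c k) := by
        gcongr
        exact norm_sum_sub_le hp hc hs j
    _ = ∑ k ∈ Finset.univ.erase j, c k * (δ / 2) ^ 2 := by
        rw [← Finset.sum_mul]
        ring
    _ ≤ ∑ k ∈ Finset.univ.erase j, c k * ‖y - p k‖ ^ 2 := by
        refine Finset.sum_le_sum fun k hk => mul_le_mul_of_nonneg_left ?_ (hc k)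
        have := far (Finset.ne_of_mem_erase hk)
        gcongr
    _ ≤ ∑ k, c k * ‖y - p k‖ ^ 2 :=
        Finset.sum_le_sum_of_subset_of_nonneg (Finset.erase_subset _ _) fun k _ _ =>
          mul_nonneg (hc k) (sq_nonneg _)

end UnitSphere

/-- The function `‖y‖⁻²`, cut off at radius 3, which dominates the hyperbolic volume density of an
inscribed polytope near a vertex. -/
def cutoff (y : EuclideanSpace ℝ (Fin 3)) : ENNReal :=
  (Metric.ball 0 3).indicator (fun y => ENNReal.ofReal (‖y‖ ^ 2)⁻¹) y

lemma measurable_cutoff : Measurable cutoff :=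
  Measurable.indicator (by fun_prop) measurableSet_ball

lemma lintegral_cutoff_lt_top : ∫⁻ y, cutoff y < ⊤ := by
  have h : IntegrableOn (fun y : EuclideanSpace ℝ (Fin 3) => (‖y‖ ^ 2)⁻¹) (Metric.ball 0 3) := by
    rw [integrableOn_fun_norm_addHaar volume (f := fun r : ℝ => (r ^ 2)⁻¹)]
    refine IntegrableOn.congr_fun (f := fun _ => 1) (by simp) (fun r hr => ?_) measurableSet_Ioo
    simp [hr.1.ne']
  exact (lintegral_indicator measurableSet_ball _).trans_lt h.lintegral_lt_top

namespace IdealCone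

variable {I J : Type*} [Fintype J] (C : IdealCone I J)

/-- The ideal point of a generator. -/
def point (j : J) : EuclideanSpace ℝ (Fin 3) := radial (C.gen j)

lemma norm_point (j : J) : ‖C.point j‖ = 1 := by
  have h := norm_radial_sq (C.gen_zero_pos j).ne'
  rw [C.lor_gen_self, zero_div, add_zero] at h
  exact (pow_eq_one_iff_of_nonneg (norm_nonneg _) two_ne_zero).1 h

lemma point_injective : Function.Injective C.point := by
  intro j k h
  by_contra hne
  have hj := (C.gen_zero_pos j).ne'
  have hk := (C.gen_zero_pos k).ne'
  have hcoord (i : Fin 3) : C.gen j i.succ / C.gen j 0 = C.gen k i.succ / C.gen k 0 :=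
    congrFun (congrArg WithLp.ofLp h) i
  have hprop : C.gen j = (C.gen j 0 / C.gen k 0) • C.gen k := by
    ext i
    rw [Pi.smul_apply, smul_eq_mul]
    cases i using Fin.cases with
    | zero => rw [div_mul_cancel₀ _ hk]
    | succ i => rw [div_mul_comm, ← hcoord, div_mul_cancel₀ _ hj]
  have := C.lor_gen_gen_neg j k hne
  rw [hprop, lor_smul_left, C.lor_gen_self, mul_zero] at this
  exact this.false

lemma exists_convex_combination {K : Set J} {x : H3} (hx : x ∈ C.hull K) :
    ∃ c ∈ stdSimplex ℝ J, (∀ j ∉ K, c j = 0) ∧ klein x = ∑ j, c j • C.point j := by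
  obtain ⟨c, hc, hcK, hxc⟩ := hx
  have hx0 := x.2.2
  refine ⟨fun j => c j * C.gen j 0 / x.1 0, ⟨fun j => ?_, ?_⟩, fun j hj => ?_, ?_⟩
  · exact div_nonneg (mul_nonneg (hc j) (C.gen_zero_pos j).le) hx0.le
  · rw [← Finset.sum_div, div_eq_one_iff_eq hx0.ne']
    simpa using (congrFun hxc 0).symm
  · simp only [hcK j hj, zero_mul, zero_div]
  · ext i
    simp only [klein, point, radial, congrFun hxc i.succ, Finset.sum_apply, Pi.smul_apply,
      smul_eq_mul, Finset.sum_div, WithLp.ofLp_sum, WithLp.ofLp_smul]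
    refine Finset.sum_congr rfl fun j _ => ?_
    have := (C.gen_zero_pos j).ne'
    field_simp

lemma closure_klein_hull_subset (K : Set J) : closure (klein '' C.hull K) ⊆
    (fun c : J → ℝ => ∑ j, c j • C.point j) '' (stdSimplex ℝ J ∩ {c | ∀ j ∉ K, c j = 0}) := by
  have hclosed : IsClosed {c : J → ℝ | ∀ j ∉ K, c j = 0} := by
    simp only [Set.ofPred_forall]
    exact isClosed_iInter fun j => isClosed_iInter fun _ =>
      isClosed_eq (continuous_apply j) continuous_const
  refine closure_minimal ?_
    (((isCompact_stdSimplex ℝ J).inter_right hclosed).image (by fun_prop)).isClosed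
  rintro _ ⟨x, hx, rfl⟩
  obtain ⟨c, hc, hcK, hxc⟩ := C.exists_convex_combination hx
  exact ⟨c, ⟨hc, hcK⟩, hxc.symm⟩

lemma pointsAtInfinity_hull_subset (K : Set J) : pointsAtInfinity (C.hull K) ⊆ C.point '' K := by
  rintro y ⟨hy1, hy⟩
  obtain ⟨c, ⟨⟨hc, hs⟩, hcK⟩, rfl⟩ := C.closure_klein_hull_subset K hy
  obtain ⟨k, -, hk⟩ := Finset.exists_ne_zero_of_sum_ne_zero (hs.trans_ne one_ne_zero)
  have hzero := one_sub_norm_sq_eq_sum C.norm_point hs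
  rw [mem_sphere_zero_iff_norm.1 hy1, one_pow, sub_self, eq_comm,
    Finset.sum_eq_zero_iff_of_nonneg fun k _ => mul_nonneg (hc k) (sq_nonneg _)] at hzero
  have hdist := (mul_eq_zero.1 (hzero k (Finset.mem_univ k))).resolve_left hk
  refine ⟨k, not_imp_comm.1 (hcK k) hk, (sub_eq_zero.1 (norm_eq_zero.1 ?_)).symm⟩
  exact eq_zero_of_pow_eq_zero hdist

lemma tendsto_radial_add_smul (j k : J) :
    Filter.Tendsto (fun s : ℝ => radial (C.gen j + s • C.gen k)) (nhds 0) (nhds (C.point j)) := by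
  have h0 : (C.gen j + (0 : ℝ) • C.gen k) 0 ≠ 0 := by simpa using (C.gen_zero_pos j).ne'
  have hcont : ContinuousAt (fun s : ℝ => radial (C.gen j + s • C.gen k)) 0 :=
    (PiLp.continuous_toLp 2 _).continuousAt.comp (continuousAt_pi.2 fun i =>
      ContinuousAt.div (by fun_prop) (by fun_prop) h0)
  simpa only [point, zero_smul, add_zero] using hcont.tendsto

lemma pointsAtInfinity_hull {K : Set J} (hK : K.Nontrivial) :
    pointsAtInfinity (C.hull K) = C.point '' K := by
  refine (C.pointsAtInfinity_hull_subset K).antisymm ?_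
  rintro _ ⟨j, hj, rfl⟩
  obtain ⟨k, hk, hkj⟩ := hK.exists_ne j
  refine ⟨mem_sphere_zero_iff_norm.2 (C.norm_point j), mem_closure_of_tendsto
    ((C.tendsto_radial_add_smul j k).mono_left (nhdsWithin_le_nhds (s := Set.Ioi 0))) ?_⟩
  filter_upwards [self_mem_nhdsWithin] with s hs
  obtain ⟨x, hx, c, hc, hxc⟩ := C.exists_mem_hull_pair hkj.symm hj hk hs
  exact ⟨x, hx, by rw [klein_eq_radial, hxc, radial_smul hc.ne']⟩

lemma poly_eq_hull : C.poly = C.hull Set.univ := by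
  refine Set.Subset.antisymm (fun x hx => ?_) (C.hull_subset_poly _)
  obtain ⟨c, hc, hxc⟩ := C.exists_combination x.1 hx
  exact ⟨c, hc, fun j hj => (hj (Set.mem_univ j)).elim, hxc⟩

lemma idealVertices_poly : idealVertices C.poly = Set.range C.point := by
  have := C.nontrivial_gens
  rw [idealVertices, poly_eq_hull, C.pointsAtInfinity_hull Set.nontrivial_univ, Set.image_univ]

lemma point_mem_pointsAtInfinity_face (i : I) (j : J) :
    C.point j ∈ pointsAtInfinity (C.face i) ↔ lor (C.gen j) (C.normal i) = 0 := by
  rw [C.face_eq_hull, C.pointsAtInfinity_hull (C.nontrivial_gensOn_normal i),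
    C.point_injective.mem_set_image]
  rfl

lemma volume_density_le {δ : ℝ} (hδ : 0 < δ) (hδp : ∀ j k, j ≠ k → δ ≤ ‖C.point j - C.point k‖)
    {x : H3} (hx : x ∈ C.poly) : ENNReal.ofReal (1 / (1 - ‖klein x‖ ^ 2) ^ 2) ≤
      ∑ j, ENNReal.ofReal (((δ ^ 2 / 8) ^ 2)⁻¹) * cutoff (klein x - C.point j) := by
  have hx1 := norm_klein_lt_one x
  rw [C.poly_eq_hull] at hx
  obtain ⟨c, ⟨hc, hs⟩, -, hxc⟩ := C.exists_convex_combination hx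
  obtain ⟨j, hj⟩ := exists_mul_norm_sub_le C.norm_point hδ hδp hc hs
  rw [← hxc] at hj
  have hpos : 0 < ‖klein x - C.point j‖ := by
    have := norm_sub_norm_le (C.point j) (klein x)
    rw [C.norm_point, norm_sub_rev] at this
    linarith
  have hball : klein x - C.point j ∈ Metric.ball (0 : EuclideanSpace ℝ (Fin 3)) 3 := by
    rw [mem_ball_zero_iff]
    have := norm_sub_le (klein x) (C.point j)
    rw [C.norm_point] at this
    linarith
  refine le_trans ?_ (Finset.single_le_sum (f := fun j =>
    ENNReal.ofReal (((δ ^ 2 / 8) ^ 2)⁻¹) * cutoff (klein x - C.point j))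
    (fun _ _ => zero_le) (Finset.mem_univ j))
  rw [cutoff, Set.indicator_of_mem hball, ← ENNReal.ofReal_mul (by positivity), ← mul_inv,
    ← mul_pow, one_div]
  gcongr

lemma hvol_poly_lt_top : hvol C.poly < ⊤ := by
  obtain ⟨δ, hδ, hδp⟩ := exists_pos_le_norm_sub C.point_injective
  have hmeas (j : J) : Measurable fun y => cutoff (y - C.point j) :=
    measurable_cutoff.comp (measurable_id.sub_const _)
  calc hvol C.poly
      ≤ ∫⁻ y in klein '' C.poly,
          ∑ j, ENNReal.ofReal (((δ ^ 2 / 8) ^ 2)⁻¹) * cutoff (y - C.point j) :=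
        setLIntegral_mono (Finset.measurable_fun_sum _ fun j _ => (hmeas j).const_mul _)
          (Set.forall_mem_image.2 fun _ => C.volume_density_le hδ hδp)
    _ ≤ ∫⁻ y, ∑ j, ENNReal.ofReal (((δ ^ 2 / 8) ^ 2)⁻¹) * cutoff (y - C.point j) :=
        setLIntegral_le_lintegral _ _
    _ = ∑ j : J, ENNReal.ofReal (((δ ^ 2 / 8) ^ 2)⁻¹) * ∫⁻ y, cutoff y := by
        rw [lintegral_finsetSum _ fun j _ => (hmeas j).const_mul _]
        refine Finset.sum_congr rfl fun j _ => ?_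
        rw [lintegral_const_mul _ (hmeas j), lintegral_sub_right_eq_self (fun y => cutoff y)]
    _ < ⊤ := ENNReal.sum_lt_top.2 fun _ _ =>
        ENNReal.mul_lt_top ENNReal.ofReal_lt_top lintegral_cutoff_lt_top

lemma isPolyhedron : IsPolyhedron C.poly := by
  have := C.finite_walls
  refine ⟨⟨Set.range C.normal, Set.finite_range _, Set.forall_mem_range.2 C.lor_normal_self, ?_⟩,
    C.interior_nonempty, C.hvol_poly_lt_top⟩
  ext x
  exact (Set.forall_mem_range (p := fun e => lor x.1 e ≤ 0)).symm

lemma isIdealPolyhedron : IsIdealPolyhedron C.poly :=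
  ⟨C.isPolyhedron, fun x => C.not_isFace_zero {x}⟩

lemma isEquiangular : IsEquiangular (Real.pi / 3) C.poly := by
  refine ⟨C.isPolyhedron, fun F G hFG e f he hf => ?_⟩
  obtain ⟨i, rfl⟩ := C.isFace_two_iff.1 hFG.1
  obtain ⟨i', rfl⟩ := C.isFace_two_iff.1 hFG.2.1
  rw [C.eq_normal_of_isOuterNormal he, C.eq_normal_of_isOuterNormal hf, C.adjacent_iff.1 hFG,
    show (-1 / 2 : ℝ) = -(1 / 2) by norm_num, Real.arccos_neg, ← Real.cos_pi_div_three,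
    Real.arccos_cos (by positivity) (by linarith [Real.pi_pos]), sub_sub_cancel]

end IdealCone

/-! ### Coordinates adapted to an ideal point -/

/-- The height of a vector with barycentric coordinates `z`, normalised so that the triangle of the
pattern, whose points have coordinate sum `3 * n`, lies at height `1`. -/
def level (n : ℝ) (z : Fin 3 → ℝ) : ℝ := (∑ i, z i) / (3 * n)

/-- The vector of `ℝ^{1,3}` with barycentric coordinates `z` with respect to three planes through a
common ideal point, and coordinate `v` in the direction of that ideal point. -/
def vec (n : ℝ) (z : Fin 3 → ℝ) (v : ℝ) : Fin 4 → ℝ :=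
  ![(level n z + (2 / 3 * v - 2 * n ^ 2 * level n z)) / 2, n * level n z - z 0,
    (z 2 - z 1) / √3, ((2 / 3 * v - 2 * n ^ 2 * level n z) - level n z) / 2]

/-- The ideal point over the point `z` of the horosphere: in the upper half-space model these are
the finite points of the boundary plane. -/
def idealPt (n : ℝ) (z : Fin 3 → ℝ) : Fin 4 → ℝ := vec n z (z ⬝ᵥ z)

/-- The ideal point that is the point at infinity of the upper half-space model. -/
def inftyPt (n : ℝ) : Fin 4 → ℝ := vec n 0 1

/-- The outer unit normal of the exterior of the hemisphere with centre `c` and radius `√6`, in the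
metric in which `idealPt n z` and `idealPt n z'` are at distance `|z - z'|`. -/
def sphereNormal (n : ℝ) (c : Fin 3 → ℝ) : Fin 4 → ℝ := vec n ((1 / 2 : ℝ) • c) ((c ⬝ᵥ c - 6) / 2)

/-- The outer unit normal of the vertical half-space `0 ≤ z i`. -/
def sideNormal (n : ℝ) (i : Fin 3) : Fin 4 → ℝ :=
  vec n (fun k => 1 / 2 - if k = i then 3 / 2 else 0) (3 * n)

section Coordinates

variable {n : ℝ}

lemma level_smul (n c : ℝ) (z : Fin 3 → ℝ) : level n (c • z) = c * level n z := by
  simp only [level, Pi.smul_apply, smul_eq_mul, ← Finset.mul_sum, mul_div_assoc]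

lemma level_zero (n : ℝ) : level n 0 = 0 := by simp [level]

lemma vec_add (n : ℝ) (z z' : Fin 3 → ℝ) (v v' : ℝ) :
    vec n (z + z') (v + v') = vec n z v + vec n z' v' := by
  ext i
  fin_cases i <;> simp [vec, level, Finset.sum_add_distrib] <;> ring

lemma vec_smul (n c : ℝ) (z : Fin 3 → ℝ) (v : ℝ) : vec n (c • z) (c * v) = c • vec n z v := by
  ext i
  fin_cases i <;> simp [vec, level_smul] <;> ring

lemma exists_eq_vec (hn : n ≠ 0) (x : Fin 4 → ℝ) : ∃ z v, x = vec n z v := by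
  have h3 : √3 * √3 = 3 := Real.mul_self_sqrt (by norm_num)
  refine ⟨![n * (x 0 - x 3) - x 1, n * (x 0 - x 3) + (x 1 - √3 * x 2) / 2,
    n * (x 0 - x 3) + (x 1 + √3 * x 2) / 2],
    3 / 2 * (x 0 + x 3 + 2 * n ^ 2 * (x 0 - x 3)), ?_⟩
  ext i
  fin_cases i <;> simp [vec, level, Fin.sum_univ_three] <;> field_simp <;> ring

lemma lor_vec (hn : n ≠ 0) (z z' : Fin 3 → ℝ) (v v' : ℝ) :
    lor (vec n z v) (vec n z' v') =
      2 / 3 * (z ⬝ᵥ z' - (level n z * v' + level n z' * v) / 2) := by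
  have hsum (w : Fin 3 → ℝ) : w 2 = 3 * n * level n w - w 0 - w 1 := by
    simp only [level, Fin.sum_univ_three]
    field_simp
    ring
  have hsqrt : (z 2 - z 1) / √3 * ((z' 2 - z' 1) / √3) = (z 2 - z 1) * (z' 2 - z' 1) / 3 := by
    rw [div_mul_div_comm, Real.mul_self_sqrt (by norm_num)]
  simp only [lor, vec, dotProduct, Fin.sum_univ_three, Matrix.cons_val_zero, Matrix.cons_val_one,
    Matrix.cons_val, hsqrt]
  rw [hsum z, hsum z']
  ring

lemma lor_idealPt_idealPt (hn : n ≠ 0) {z z' : Fin 3 → ℝ} (hz : level n z = 1)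
    (hz' : level n z' = 1) :
    lor (idealPt n z) (idealPt n z') = -((z - z') ⬝ᵥ (z - z')) / 3 := by
  rw [idealPt, idealPt, lor_vec hn, hz, hz']
  simp only [sub_dotProduct, dotProduct_sub, dotProduct_comm z' z]
  ring

lemma lor_inftyPt_idealPt (hn : n ≠ 0) {z : Fin 3 → ℝ} (hz : level n z = 1) :
    lor (inftyPt n) (idealPt n z) = -1 / 3 := by
  rw [inftyPt, idealPt, lor_vec hn, hz, level_zero, zero_dotProduct]
  norm_num

lemma lor_inftyPt_self (hn : n ≠ 0) : lor (inftyPt n) (inftyPt n) = 0 := by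
  rw [inftyPt, lor_vec hn, level_zero, zero_dotProduct]
  norm_num

lemma lor_vec_sphereNormal (hn : n ≠ 0) (z : Fin 3 → ℝ) (v : ℝ) {c : Fin 3 → ℝ}
    (hc : level n c = 1) :
    lor (vec n z v) (sphereNormal n c) = (2 * z ⬝ᵥ c - level n z * (c ⬝ᵥ c - 6) - v) / 6 := by
  rw [sphereNormal, lor_vec hn, level_smul, hc, dotProduct_smul, smul_eq_mul]
  ring

lemma lor_idealPt_sphereNormal (hn : n ≠ 0) {z c : Fin 3 → ℝ} (hz : level n z = 1)
    (hc : level n c = 1) :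
    lor (idealPt n z) (sphereNormal n c) = 1 - (z - c) ⬝ᵥ (z - c) / 6 := by
  rw [idealPt, lor_vec_sphereNormal hn _ _ hc, hz]
  simp only [sub_dotProduct, dotProduct_sub, dotProduct_comm c z]
  ring

lemma lor_inftyPt_sphereNormal (hn : n ≠ 0) {c : Fin 3 → ℝ} (hc : level n c = 1) :
    lor (inftyPt n) (sphereNormal n c) = -1 / 6 := by
  rw [inftyPt, lor_vec_sphereNormal hn _ _ hc, level_zero, zero_dotProduct]
  norm_num

lemma lor_sphereNormal_sphereNormal (hn : n ≠ 0) {c c' : Fin 3 → ℝ} (hc : level n c = 1)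
    (hc' : level n c' = 1) :
    lor (sphereNormal n c) (sphereNormal n c') = 1 - (c - c') ⬝ᵥ (c - c') / 12 := by
  rw [sphereNormal, lor_vec_sphereNormal hn _ _ hc', level_smul, hc]
  simp only [sub_dotProduct, dotProduct_sub, dotProduct_comm c' c, smul_dotProduct, smul_eq_mul]
  ring

lemma lor_vec_sideNormal (hn : n ≠ 0) (z : Fin 3 → ℝ) (v : ℝ) (i : Fin 3) :
    lor (vec n z v) (sideNormal n i) = -z i := by
  have hlevel : level n (fun k => 1 / 2 - if k = i then 3 / 2 else 0) = 0 := by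
    rw [level, Finset.sum_sub_distrib, Finset.sum_ite_eq']
    norm_num
  have hdot : z ⬝ᵥ (fun k => 1 / 2 - if k = i then 3 / 2 else 0) =
      (∑ k, z k) / 2 - 3 / 2 * z i := by
    simp only [dotProduct, mul_sub, Finset.sum_sub_distrib, ← Finset.sum_mul, mul_ite, mul_zero,
      Finset.sum_ite_eq', Finset.mem_univ, if_true]
    ring
  rw [sideNormal, lor_vec hn, hlevel, hdot, level]
  field_simp
  ring

lemma lor_sideNormal_sideNormal (hn : n ≠ 0) (i i' : Fin 3) :
    lor (sideNormal n i) (sideNormal n i') = if i' = i then 1 else -1 / 2 := by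
  rw [sideNormal, lor_vec_sideNormal hn]
  split_ifs <;> norm_num

end Coordinates

/-! ### The triangular pattern -/

/-- The points of the triangular lattice in a triangle of side `k`. -/
abbrev Tri (k : ℕ) : Type := {f : Fin 3 → ℕ // ∑ i, f i = k}

instance (k : ℕ) : Fintype (Tri k) :=
  Fintype.subtype (Finset.piAntidiag Finset.univ k) (by simp)

/-- The points of the triangular lattice in a triangle of side `k - 1`, of which there are none
for `k = 0`. -/
abbrev DownTri (k : ℕ) : Type := {f : Fin 3 → ℕ // ∑ i, f i + 1 = k}

instance (k : ℕ) : Finite (DownTri k) :=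
  Finite.of_injective (fun f : DownTri k => (⟨f.1, by have := f.2; omega⟩ : Tri (k - 1)))
    fun _ _ h => Subtype.ext (Subtype.mk.inj h)

/-- The indices of the finite ideal vertices. The centres of the hemispheres, indexed by `Tri m`,
are the centres of the hexagons of a honeycomb, whose vertices come in two orientations. -/
abbrev FinVert (m : ℕ) : Type := Tri (m + 1) ⊕ DownTri m

/-- The indices of the ideal vertices, where `none` stands for the common point of the three
vertical sides. -/
abbrev Vert (m : ℕ) : Type := Option (FinVert m)

/-- The indices of the faces: three vertical sides and the hemispheres. -/
abbrev Wall (m : ℕ) : Type := Fin 3 ⊕ Tri m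

instance (m : ℕ) : Fintype (Vert m) := Fintype.ofFinite _

variable {m : ℕ}

/-- The lattice point that indexes a finite ideal vertex. -/
def latticePt : FinVert m → Fin 3 → ℕ
  | .inl f => f.1
  | .inr f => f.1

/-- Barycentric coordinates of a finite ideal vertex. -/
def pos : FinVert m → Fin 3 → ℝ
  | .inl f => fun i => 3 * (f.1 i : ℝ)
  | .inr f => fun i => 3 * (f.1 i : ℝ) + 2

/-- Barycentric coordinates of the centre of a hemisphere. -/
def ctr (g : Tri m) : Fin 3 → ℝ := fun i => 3 * (g.1 i : ℝ) + 1

/-- The light-like vectors of the ideal vertices. -/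
def vertVec : Vert m → Fin 4 → ℝ
  | none => inftyPt (m + 1)
  | some j => idealPt (m + 1) (pos j)

/-- The outer unit normals of the faces. -/
def wallVec : Wall m → Fin 4 → ℝ
  | .inl i => sideNormal (m + 1) i
  | .inr g => sphereNormal (m + 1) (ctr g)

/-- The squared distance of two points of the triangular lattice. -/
def sqDist (f g : Fin 3 → ℕ) : ℤ := ∑ i, ((f i : ℤ) - g i) ^ 2

lemma one_le_sqDist {f g : Fin 3 → ℕ} (h : f ≠ g) : 1 ≤ sqDist f g := by
  obtain ⟨i, hi⟩ := Function.ne_iff.1 h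
  refine Int.add_one_le_iff.2 (Finset.sum_pos' (fun _ _ => sq_nonneg _)
    ⟨i, Finset.mem_univ i, sq_pos_of_ne_zero ?_⟩)
  exact sub_ne_zero.2 (by exact_mod_cast hi)

lemma sqDist_comm (f g : Fin 3 → ℕ) : sqDist f g = sqDist g f :=
  Finset.sum_congr rfl fun _ _ => by ring

lemma sqDist_self (f : Fin 3 → ℕ) : sqDist f f = 0 := by simp [sqDist]

lemma sqDist_add_single (f : Fin 3 → ℕ) (k : Fin 3) : sqDist (f + Pi.single k 1) f = 1 := by
  simp [sqDist, Pi.single_apply]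

lemma sqDist_add_single_add_single (f : Fin 3 → ℕ) {k l : Fin 3} (h : k ≠ l) :
    sqDist (f + Pi.single k 1) (f + Pi.single l 1) = 2 := by
  simp only [sqDist, Pi.add_apply, Nat.cast_add, add_sub_add_left_eq_sub]
  revert k l
  decide

lemma eq_single_sub_single {d : Fin 3 → ℤ} (hsum : ∑ i, d i = 0) (hd : d ≠ 0)
    (hlt : ∑ i, d i ^ 2 < 4) : ∃ k l, k ≠ l ∧ d = Pi.single k 1 - Pi.single l 1 := by
  have hmem : d ∈ Fintype.piFinset fun _ : Fin 3 => ({-1, 0, 1} : Finset ℤ) := by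
    refine Fintype.mem_piFinset.2 fun i => ?_
    have hi : d i ^ 2 < 2 ^ 2 :=
      (Finset.single_le_sum (fun k _ => sq_nonneg (d k)) (Finset.mem_univ i)).trans_lt hlt
    obtain ⟨h1, h2⟩ := abs_lt.1 (abs_lt_of_sq_lt_sq hi zero_le_two)
    simp only [Finset.mem_insert, Finset.mem_singleton]
    omega
  have hall : ∀ d ∈ Fintype.piFinset fun _ : Fin 3 => ({-1, 0, 1} : Finset ℤ),
      ∑ i, d i = 0 → d ≠ 0 → ∃ k l, k ≠ l ∧ d = Pi.single k 1 - Pi.single l 1 := by decide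
  exact hall d hmem hsum hd

lemma four_le_sqDist_or_exists_eq {f g : Fin 3 → ℕ} (hne : f ≠ g) (hsum : ∑ i, f i = ∑ i, g i) :
    4 ≤ sqDist f g ∨ ∃ (w : Fin 3 → ℕ) (k l : Fin 3), k ≠ l ∧
    f = w + Pi.single k 1 ∧ g = w + Pi.single l 1 := by
  refine or_iff_not_imp_left.2 fun hlt => ?_
  obtain ⟨k, l, hkl, hd⟩ := eq_single_sub_single (d := fun i => (f i : ℤ) - g i)
    (by rw [Finset.sum_sub_distrib, sub_eq_zero]; exact_mod_cast hsum)
    (fun h => hne (funext fun i => by simpa [sub_eq_zero] using congrFun h i)) (not_le.1 hlt)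
  refine ⟨f ⊓ g, k, l, hkl, ?_⟩
  simp only [funext_iff, Pi.add_apply, Pi.inf_apply, Pi.sub_apply, Pi.single_apply] at hd ⊢
  exact ⟨fun i => by grind, fun i => by grind⟩

lemma level_pos (j : FinVert m) : level (m + 1) (pos j) = 1 := by
  rw [level, div_eq_one_iff_eq (by positivity)]
  rcases j with f | f
  · have hf : (∑ i, (f.1 i : ℝ)) = m + 1 := by exact_mod_cast f.2
    rw [← hf, Finset.mul_sum]
    rfl
  · have hf : (∑ i, (f.1 i : ℝ)) + 1 = m := by exact_mod_cast f.2
    simp only [pos, Finset.sum_add_distrib, ← Finset.mul_sum, Finset.sum_const, Finset.card_univ,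
      Fintype.card_fin, nsmul_eq_mul]
    push_cast
    linarith

lemma level_ctr (g : Tri m) : level (m + 1) (ctr g) = 1 := by
  have hg : (∑ i, (g.1 i : ℝ)) = m := by exact_mod_cast g.2
  rw [level, div_eq_one_iff_eq (by positivity)]
  simp only [ctr, Finset.sum_add_distrib, ← Finset.mul_sum, Finset.sum_const, Finset.card_univ,
    Fintype.card_fin, nsmul_eq_mul, hg]
  push_cast
  ring

lemma pos_nonneg (j : FinVert m) (i : Fin 3) : 0 ≤ pos j i := by
  rcases j with f | f <;> simp only [pos] <;> positivity

lemma pos_injective : Function.Injective (pos (m := m)) := by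
  have hmod (a b : ℕ) : (3 * (a : ℝ)) ≠ 3 * b + 2 := fun h => by
    have : 3 * a = 3 * b + 2 := by exact_mod_cast h
    omega
  rintro (f | f) (g | g) h
  · exact congrArg _ (Subtype.ext (funext fun i => by simpa [pos] using congrFun h i))
  · exact absurd (congrFun h 0) (hmod _ _)
  · exact absurd (congrFun h 0).symm (hmod _ _)
  · exact congrArg _ (Subtype.ext (funext fun i => by simpa [pos] using congrFun h i))

lemma latticePt_ne (j : FinVert m) (g : Tri m) : latticePt j ≠ g.1 := by
  intro h
  rcases j with f | f
  all_goals
    have hf := f.2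
    have hsum : ∑ i, f.1 i = ∑ i, g.1 i := congrArg (fun w => ∑ i, w i) h
    have hg := g.2
    omega

lemma lor_vert_side (j : FinVert m) (i : Fin 3) :
    lor (vertVec (some j)) (wallVec (m := m) (.inl i)) = -pos j i :=
  lor_vec_sideNormal (Nat.cast_add_one_ne_zero m) _ _ _

lemma lor_infty_side (i : Fin 3) :
    lor (vertVec (m := m) none) (wallVec (m := m) (.inl i)) = 0 :=
  (lor_vec_sideNormal (Nat.cast_add_one_ne_zero m) _ _ _).trans neg_zero

lemma lor_infty_sphere (g : Tri m) :
    lor (vertVec (m := m) none) (wallVec (.inr g)) = -1 / 6 :=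
  lor_inftyPt_sphereNormal (Nat.cast_add_one_ne_zero m) (level_ctr g)

lemma lor_vert_sphere (j : FinVert m) (g : Tri m) :
    lor (vertVec (some j)) (wallVec (.inr g)) = 3 / 2 * (1 - sqDist (latticePt j) g.1) := by
  rw [vertVec, wallVec, lor_idealPt_sphereNormal (Nat.cast_add_one_ne_zero m) (level_pos j)
    (level_ctr g)]
  have hg : (∑ i, (g.1 i : ℝ)) = m := by exact_mod_cast g.2
  rcases j with f | f
  · have hf : (∑ i, (f.1 i : ℝ)) = m + 1 := by exact_mod_cast f.2
    simp only [sqDist, latticePt, pos, ctr, dotProduct, Fin.sum_univ_three, Pi.sub_apply] at hf hg ⊢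
    push_cast
    linear_combination hf - hg
  · have hf : (∑ i, (f.1 i : ℝ)) + 1 = m := by exact_mod_cast f.2
    simp only [sqDist, latticePt, pos, ctr, dotProduct, Fin.sum_univ_three, Pi.sub_apply] at hf hg ⊢
    push_cast
    linear_combination hg - hf

lemma lor_sphere_sphere (g g' : Tri m) :
    lor (wallVec (.inr g)) (wallVec (.inr g')) = 1 - 3 / 4 * (sqDist g.1 g'.1 : ℝ) := by
  rw [wallVec, wallVec, lor_sphereNormal_sphereNormal (Nat.cast_add_one_ne_zero m) (level_ctr g)
    (level_ctr g')]
  simp only [sqDist, ctr, dotProduct, Fin.sum_univ_three, Pi.sub_apply]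
  push_cast
  ring

lemma lor_sphere_side (g : Tri m) (i : Fin 3) :
    lor (wallVec (.inr g)) (wallVec (m := m) (.inl i)) = -(3 * (g.1 i : ℝ) + 1) / 2 := by
  refine (lor_vec_sideNormal (Nat.cast_add_one_ne_zero m) _ _ _).trans ?_
  simp only [ctr, Pi.smul_apply, smul_eq_mul]
  ring

lemma lor_side_side (i i' : Fin 3) :
    lor (wallVec (m := m) (.inl i)) (wallVec (m := m) (.inl i')) = if i' = i then 1 else -1 / 2 :=
  lor_sideNormal_sideNormal (Nat.cast_add_one_ne_zero m) i i'

lemma lor_vertVec_self (j : Vert m) : lor (vertVec j) (vertVec j) = 0 := by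
  rcases j with _ | j
  · exact lor_inftyPt_self (Nat.cast_add_one_ne_zero m)
  · simp [vertVec, lor_idealPt_idealPt (Nat.cast_add_one_ne_zero m) (level_pos j) (level_pos j)]

lemma lor_vertVec_vertVec_neg (j k : Vert m) (h : j ≠ k) : lor (vertVec j) (vertVec k) < 0 := by
  have hinfty (j : FinVert m) : lor (vertVec (m := m) none) (vertVec (some j)) < 0 := by
    rw [vertVec, vertVec, lor_inftyPt_idealPt (Nat.cast_add_one_ne_zero m) (level_pos j)]
    norm_num
  rcases j with _ | j <;> rcases k with _ | k
  · exact absurd rfl h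
  · exact hinfty k
  · exact lor_comm _ _ ▸ hinfty j
  · rw [vertVec, vertVec,
      lor_idealPt_idealPt (Nat.cast_add_one_ne_zero m) (level_pos j) (level_pos k)]
    have hne : pos j - pos k ≠ 0 := sub_ne_zero.2 fun hjk => h (congrArg some (pos_injective hjk))
    have hpos : 0 < (pos j - pos k) ⬝ᵥ (pos j - pos k) := by
      refine lt_of_le_of_ne ?_ fun h0 => hne (dotProduct_self_eq_zero.1 h0.symm)
      exact Finset.sum_nonneg fun _ _ => mul_self_nonneg _
    linarith

lemma vertVec_zero_pos (j : Vert m) : 0 < vertVec j 0 := by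
  rcases j with _ | j
  · simp [vertVec, inftyPt, vec, level_zero]
  · have hsum : ∑ i, pos j i = 3 * (m + 1) := (div_eq_one_iff_eq (by positivity)).1 (level_pos j)
    simp only [vertVec, idealPt, vec, level_pos, dotProduct, Fin.sum_univ_three,
      Matrix.cons_val_zero] at hsum ⊢
    nlinarith [sq_nonneg (pos j 0 - pos j 1), sq_nonneg (pos j 0 - pos j 2),
      sq_nonneg (pos j 1 - pos j 2)]

lemma lor_wallVec_self (i : Wall m) : lor (wallVec i) (wallVec i) = 1 := by
  rcases i with i | g
  · rw [lor_side_side, if_pos rfl]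
  · rw [lor_sphere_sphere, sqDist_self]
    norm_num

lemma lor_vertVec_wallVec_nonpos (j : Vert m) (i : Wall m) :
    lor (vertVec j) (wallVec i) ≤ 0 := by
  rcases j with _ | j <;> rcases i with i | g
  · rw [lor_infty_side]
  · rw [lor_infty_sphere]
    norm_num
  · rw [lor_vert_side]
    linarith [pos_nonneg j i]
  · have hdist : (1 : ℝ) ≤ sqDist (latticePt j) g.1 := by
      exact_mod_cast one_le_sqDist (latticePt_ne j g)
    rw [lor_vert_sphere]
    linarith

lemma sum_add_single (f : Fin 3 → ℕ) (k : Fin 3) (a : ℕ) :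
    ∑ i, (f + Pi.single k a : Fin 3 → ℕ) i = ∑ i, f i + a := by
  simp [Finset.sum_add_distrib]

/-- The vertex of the hexagon of `g` in the direction of the `k`-th corner. -/
def upVert (g : Tri m) (k : Fin 3) : FinVert m :=
  .inl ⟨g.1 + Pi.single k 1, by rw [sum_add_single, g.2]⟩

/-- The ideal vertex in the `k`-th corner of the triangle. -/
def corner (k : Fin 3) : FinVert m := .inl ⟨Pi.single k (m + 1), by simp⟩

lemma upVert_injective (g : Tri m) : Function.Injective (upVert g) := by
  intro k l h
  simpa [upVert, latticePt, Pi.single_apply] using congrFun (congrArg latticePt h) k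

lemma corner_injective : Function.Injective (corner (m := m)) := by
  intro k l h
  simpa [corner, latticePt, Pi.single_apply] using congrFun (congrArg latticePt h) k

lemma lor_vert_sphere_eq_zero {j : FinVert m} {g : Tri m} (h : sqDist (latticePt j) g.1 = 1) :
    lor (vertVec (some j)) (wallVec (.inr g)) = 0 := by
  rw [lor_vert_sphere, h]
  norm_num

lemma lor_upVert_sphere (g : Tri m) (k : Fin 3) :
    lor (vertVec (some (upVert g k))) (wallVec (.inr g)) = 0 :=
  lor_vert_sphere_eq_zero (sqDist_add_single _ _)

lemma lor_down_sphere {f : DownTri m} {g : Tri m} {k : Fin 3} (h : g.1 = f.1 + Pi.single k 1) :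
    lor (vertVec (some (.inr f))) (wallVec (.inr g)) = 0 :=
  lor_vert_sphere_eq_zero (by rw [sqDist_comm, h]; exact sqDist_add_single _ _)

lemma lor_upVert_side {g : Tri m} {k i : Fin 3} (hg : g.1 i = 0) (h : i ≠ k) :
    lor (vertVec (some (upVert g k))) (wallVec (m := m) (.inl i)) = 0 := by
  rw [lor_vert_side]
  simp [upVert, pos, hg, h]

lemma lor_corner_side {k i : Fin 3} (h : i ≠ k) :
    lor (vertVec (m := m) (some (corner k))) (wallVec (m := m) (.inl i)) = 0 := by
  rw [lor_vert_side]
  simp [corner, pos, h]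

lemma two_lt_ncard_vert_on_wall (i : Wall m) :
    2 < {j : Vert m | lor (vertVec j) (wallVec i) = 0}.ncard := by
  rw [Set.two_lt_ncard_iff]
  rcases i with i | g
  · refine ⟨none, some (corner (i + 1)), some (corner (i + 2)), lor_infty_side i,
      lor_corner_side (by simp), lor_corner_side (by simp), by simp, by simp, ?_⟩
    rw [Ne, Option.some_inj, corner_injective.eq_iff]
    simp
  · have hne {k l : Fin 3} (h : k ≠ l) : some (upVert g k) ≠ some (upVert g l) :=
      (Option.some_injective _).ne ((upVert_injective g).ne h)
    exact ⟨some (upVert g 0), some (upVert g 1), some (upVert g 2), lor_upVert_sphere g 0,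
      lor_upVert_sphere g 1, lor_upVert_sphere g 2, hne (by decide), hne (by decide),
      hne (by decide)⟩

/-- The ideal vertices that two walls have in common. -/
def commonVerts (i i' : Wall m) : Set (Vert m) :=
  {j | lor (vertVec j) (wallVec i) = 0 ∧ lor (vertVec j) (wallVec i') = 0}

lemma commonVerts_comm (i i' : Wall m) : commonVerts i i' = commonVerts i' i :=
  Set.ext fun _ => and_comm

lemma commonVerts_side_side_nontrivial (i i' : Fin 3) :
    (commonVerts (m := m) (.inl i) (.inl i')).Nontrivial := by
  obtain ⟨k, hk, hk'⟩ : ∃ k, i ≠ k ∧ i' ≠ k := by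
    revert i i'
    decide
  exact ⟨none, ⟨lor_infty_side i, lor_infty_side i'⟩, some (corner k),
    ⟨lor_corner_side hk, lor_corner_side hk'⟩, by simp⟩

lemma commonVerts_sphere_side_nontrivial {g : Tri m} {i : Fin 3} (hg : g.1 i = 0) :
    (commonVerts (.inr g) (.inl i)).Nontrivial := by
  refine ⟨some (upVert g (i + 1)), ⟨lor_upVert_sphere g _, lor_upVert_side hg (by simp)⟩,
    some (upVert g (i + 2)), ⟨lor_upVert_sphere g _, lor_upVert_side hg (by simp)⟩, ?_⟩
  rw [Ne, Option.some_inj, (upVert_injective g).eq_iff]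
  simp

/-- The hexagons of `w + k` and `w + l` share the edge between the vertices `w` and `w + k + l`. -/
lemma commonVerts_sphere_sphere_nontrivial {g g' : Tri m} {w : Fin 3 → ℕ} {k l : Fin 3}
    (hg : g.1 = w + Pi.single k 1) (hg' : g'.1 = w + Pi.single l 1) :
    (commonVerts (.inr g) (.inr g')).Nontrivial := by
  have hw : ∑ i, w i + 1 = m := by rw [← g.2, hg, sum_add_single]
  have hup : upVert g l = upVert g' k := by
    simp only [upVert, hg, hg', add_right_comm]
  exact ⟨some (upVert g l), ⟨lor_upVert_sphere g l, hup ▸ lor_upVert_sphere g' k⟩,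
    some (.inr ⟨w, hw⟩), ⟨lor_down_sphere hg, lor_down_sphere hg'⟩, by simp [upVert]⟩

lemma lor_side_sphere_angle (i : Fin 3) (g : Tri m) :
    lor (wallVec (.inr g)) (wallVec (m := m) (.inl i)) ≤ -1 ∨
      (lor (wallVec (.inr g)) (wallVec (m := m) (.inl i)) = -1 / 2 ∧
        (commonVerts (.inr g) (.inl i)).Nontrivial) := by
  rw [lor_sphere_side]
  rcases Nat.eq_zero_or_pos (g.1 i) with h | h
  · exact Or.inr ⟨by rw [h]; norm_num, commonVerts_sphere_side_nontrivial h⟩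
  · have : (1 : ℝ) ≤ g.1 i := by exact_mod_cast h
    exact Or.inl (by linarith)

lemma lor_sphere_sphere_angle {g g' : Tri m} (h : g ≠ g') :
    lor (wallVec (.inr g)) (wallVec (.inr g')) ≤ -1 ∨
      (lor (wallVec (.inr g)) (wallVec (.inr g')) = -1 / 2 ∧
        (commonVerts (.inr g) (.inr g')).Nontrivial) := by
  rw [lor_sphere_sphere]
  rcases four_le_sqDist_or_exists_eq (Subtype.coe_ne_coe.2 h) (g.2.trans g'.2.symm) with
    h4 | ⟨w, k, l, hkl, hg, hg'⟩
  · have : (4 : ℝ) ≤ sqDist g.1 g'.1 := by exact_mod_cast h4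
    exact Or.inl (by linarith)
  · refine Or.inr ⟨?_, commonVerts_sphere_sphere_nontrivial hg hg'⟩
    rw [hg, hg', sqDist_add_single_add_single w hkl]
    norm_num

lemma lor_wallVec_angle (i i' : Wall m) (h : i ≠ i') : lor (wallVec i) (wallVec i') ≤ -1 ∨
    (lor (wallVec i) (wallVec i') = -1 / 2 ∧ (commonVerts i i').Nontrivial) := by
  rcases i with i | g <;> rcases i' with i' | g'
  · refine Or.inr ⟨?_, commonVerts_side_side_nontrivial i i'⟩
    rw [lor_side_side, if_neg fun h' => h (by rw [h'])]
  · rw [lor_comm, commonVerts_comm]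
    exact lor_side_sphere_angle i g'
  · exact lor_side_sphere_angle i' g
  · exact lor_sphere_sphere_angle fun h' => h (by rw [h'])

/-! ### The cone is spanned by the ideal vertices -/

/-- The cone spanned by the ideal vertices. -/
def vertCone (m : ℕ) : Submodule NNReal (Fin 4 → ℝ) :=
  Submodule.span NNReal (Set.range (vertVec (m := m)))

lemma smul_mem_vertCone {x : Fin 4 → ℝ} (hx : x ∈ vertCone m) {c : ℝ} (hc : 0 ≤ c) :
    c • x ∈ vertCone m :=
  (vertCone m).smul_mem (⟨c, hc⟩ : NNReal) hx

lemma vertVec_mem_vertCone (j : Vert m) : vertVec j ∈ vertCone m :=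
  Submodule.subset_span ⟨j, rfl⟩

lemma sum_smul_vertVec {ι : Type*} [Fintype ι] (j : ι → FinVert m) (c : ι → ℝ) :
    ∑ k, c k • vertVec (some (j k)) =
      vec (m + 1) (∑ k, c k • pos (j k)) (∑ k, c k * pos (j k) ⬝ᵥ pos (j k)) := by
  simp only [vertVec, idealPt, ← vec_smul]
  have hzero : vec ((m : ℝ) + 1) 0 0 = 0 := by simpa using vec_smul (m + 1) 0 0 0
  let φ : (Fin 3 → ℝ) × ℝ →+ (Fin 4 → ℝ) :=
    { toFun := fun p => vec (m + 1) p.1 p.2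
      map_zero' := hzero
      map_add' := fun p q => vec_add _ _ _ _ _ }
  have hsum := map_sum φ (fun k => (c k • pos (j k), c k * pos (j k) ⬝ᵥ pos (j k))) Finset.univ
  simpa only [φ, AddMonoidHom.coe_mk, ZeroHom.coe_mk, Prod.fst_sum, Prod.snd_sum] using hsum.symm

/-- The vertices `j k` lie on the hemisphere of `g`, so a point above the hemisphere and over their
convex hull is a combination of them and of the vertex at infinity. -/
lemma mem_vertCone_of_eq_sum {ι : Type*} [Fintype ι] (g : Tri m) (j : ι → FinVert m) {c : ι → ℝ}
    (hc : ∀ k, 0 ≤ c k) (hj : ∀ k, c k = 0 ∨ lor (vertVec (some (j k))) (wallVec (.inr g)) = 0)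
    {z : Fin 3 → ℝ} {v : ℝ} (hz : z = ∑ k, c k • pos (j k))
    (hv : lor (vec (m + 1) z v) (wallVec (.inr g)) ≤ 0) : vec (m + 1) z v ∈ vertCone m := by
  set t : ℝ := v - ∑ k, c k * pos (j k) ⬝ᵥ pos (j k) with ht
  have hvec : vec (m + 1) z v = ∑ k, c k • vertVec (some (j k)) + t • vertVec (m := m) none := by
    rw [sum_smul_vertVec, vertVec, inftyPt, ← vec_smul, ← vec_add, ← hz, ht]
    simp
  have ht0 : 0 ≤ t := by
    have hzero : ∑ k, c k * lor (vertVec (some (j k))) (wallVec (.inr g)) = 0 :=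
      Finset.sum_eq_zero fun k _ => mul_eq_zero.2 (hj k)
    rw [hvec, lor_add_left, lor_sum_left] at hv
    simp only [lor_smul_left, lor_infty_sphere, hzero] at hv
    linarith
  rw [hvec]
  exact add_mem (sum_mem fun k _ => smul_mem_vertCone (vertVec_mem_vertCone _) (hc k))
    (smul_mem_vertCone (vertVec_mem_vertCone _) ht0)

lemma exists_eq_add_single {f : Fin 3 → ℕ} {k : Fin 3} (h : f k ≠ 0) :
    ∃ w : Fin 3 → ℕ, f = w + Pi.single k 1 := by
  refine ⟨f - Pi.single k 1, funext fun i => ?_⟩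
  by_cases hi : i = k
  · subst hi
    simp [Nat.sub_add_cancel (Nat.one_le_iff_ne_zero.2 h)]
  · simp [hi]

lemma exists_lattice_triangle {a : Fin 3 → ℝ} (ha : ∀ k, 0 ≤ a k) (hs : ∑ k, a k = m + 1) :
    ∃ i : Fin 3 → ℕ, (∀ k, (i k : ℝ) ≤ a k ∧ a k ≤ i k + 1) ∧
      (∑ k, i k = m ∨ ∑ k, i k + 1 = m) := by
  set r : Fin 3 → ℕ := fun k => ⌊a k⌋₊
  have h1 (k) : (r k : ℝ) ≤ a k := Nat.floor_le (ha k)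
  have h2 (k) : a k < r k + 1 := Nat.lt_floor_add_one _
  have hle : ∑ k, r k ≤ m + 1 := by
    have : (∑ k, (r k : ℝ)) ≤ m + 1 := hs ▸ Finset.sum_le_sum fun k _ => h1 k
    exact_mod_cast this
  have hlt : m + 1 < ∑ k, r k + 3 := by
    have : (m : ℝ) + 1 < ∑ k, ((r k : ℝ) + 1) :=
      hs ▸ Finset.sum_lt_sum_of_nonempty Finset.univ_nonempty fun k _ => h2 k
    rw [Finset.sum_add_distrib] at this
    norm_num at this
    exact_mod_cast this
  obtain hlt' | heq := hle.lt_or_eq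
  · exact ⟨r, fun k => ⟨h1 k, (h2 k).le⟩, by omega⟩
  · have hint (k) : (r k : ℝ) = a k := by
      refine (Finset.sum_eq_sum_iff_of_le fun k _ => h1 k).1 ?_ k (Finset.mem_univ k)
      rw [hs]
      exact_mod_cast heq
    obtain ⟨k, -, hk⟩ := Finset.exists_ne_zero_of_sum_ne_zero (heq.trans_ne (Nat.succ_ne_zero m))
    obtain ⟨w, hw⟩ := exists_eq_add_single hk
    refine ⟨w, fun l => ?_, Or.inl (by rw [hw, sum_add_single] at heq; omega)⟩
    have hl : r l = w l + Pi.single (M := fun _ => ℕ) k 1 l := congrFun hw l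
    rw [← hint l, hl, Pi.single_apply]
    split_ifs <;> simp

/-- The vertices of the downward triangle of the lattice with centre `i + 2 / 3`. -/
def downCorner (i : Fin 3 → ℕ) (hi : ∑ k, i k + 1 = m) (k : Fin 3) : FinVert m :=
  .inl ⟨i + fun l => if l = k then 0 else 1, by
    simp only [Pi.add_apply, Finset.sum_add_distrib, ← hi, add_assoc, Nat.add_left_cancel_iff]
    revert k
    decide⟩

lemma lor_downCorner_sphere {i : Fin 3 → ℕ} (hi : ∑ k, i k + 1 = m) {k l : Fin 3} (hkl : k ≠ l)
    {g : Tri m} (hg : g.1 = i + Pi.single k 1) :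
    lor (vertVec (some (downCorner i hi l))) (wallVec (.inr g)) = 0 := by
  refine lor_vert_sphere_eq_zero ?_
  simp only [sqDist, latticePt, downCorner, hg, Pi.add_apply, Nat.cast_add, add_sub_add_left_eq_sub]
  clear hg
  revert k l
  decide

lemma pos_upVert (g : Tri m) (k l : Fin 3) :
    pos (upVert g k) l = 3 * g.1 l + if l = k then 3 else 0 := by
  by_cases h : l = k <;> simp [pos, upVert, h]
  ring

lemma pos_downCorner {i : Fin 3 → ℕ} (hi : ∑ k, i k + 1 = m) (k l : Fin 3) :
    pos (downCorner i hi k) l = 3 * (i l + 1) - if l = k then 3 else 0 := by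
  by_cases h : l = k <;> simp [pos, downCorner, h]
  ring

lemma vec_mem_vertCone_of_mem_upTriangle {z : Fin 3 → ℝ} {v : ℝ} (g : Tri m)
    (hs : ∑ k, z k = 3 * (m + 1)) (hg : ∀ k, g.1 k ≤ z k / 3)
    (hv : lor (vec (m + 1) z v) (wallVec (.inr g)) ≤ 0) : vec (m + 1) z v ∈ vertCone m := by
  refine mem_vertCone_of_eq_sum g (upVert g) (c := fun k => z k / 3 - g.1 k)
    (fun k => sub_nonneg.2 (hg k)) (fun k => Or.inr (lor_upVert_sphere g k)) ?_ hv
  have hsum : ∑ k, (z k / 3 - g.1 k) = 1 := by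
    have hgs : (∑ k, (g.1 k : ℝ)) = m := by exact_mod_cast g.2
    rw [Finset.sum_sub_distrib, ← Finset.sum_div, hs, hgs]
    ring
  ext l
  simp only [Finset.sum_apply, Pi.smul_apply, smul_eq_mul, pos_upVert, mul_add,
    Finset.sum_add_distrib, ← Finset.sum_mul, hsum, mul_ite, mul_zero, Finset.sum_ite_eq,
    Finset.mem_univ, if_true]
  ring

/-- The downward triangle has its vertex `k` on the hemisphere of `i + k'` for `k ≠ k'`, and so is
its centre. If `k` minimises the barycentric coordinate `b k`, then the point lies in the triangle
spanned by the centre and the two vertices other than `k`. -/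
lemma vec_mem_vertCone_of_mem_downTriangle {z : Fin 3 → ℝ} {v : ℝ} {i : Fin 3 → ℕ}
    (hi : ∑ k, i k + 1 = m) (hs : ∑ k, z k = 3 * (m + 1)) (hz : ∀ k, z k / 3 ≤ i k + 1)
    (hv : ∀ g : Tri m, lor (vec (m + 1) z v) (wallVec (.inr g)) ≤ 0) :
    vec (m + 1) z v ∈ vertCone m := by
  set b : Fin 3 → ℝ := fun k => i k + 1 - z k / 3 with hb
  have hsum : ∑ k, b k = 1 := by
    have his : (∑ k, (i k : ℝ)) + 1 = m := by exact_mod_cast hi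
    simp only [hb, Finset.sum_sub_distrib, Finset.sum_add_distrib, ← Finset.sum_div, hs]
    norm_num
    linarith
  obtain ⟨k, hk⟩ := Finite.exists_min b
  set g : Tri m := ⟨i + Pi.single k 1, by rw [sum_add_single, hi]⟩
  refine mem_vertCone_of_eq_sum g
    (fun o : Option (Fin 3) => o.elim (.inr ⟨i, hi⟩) (downCorner i hi))
    (c := fun o => o.elim (3 * b k) fun l => b l - b k) ?_ ?_ ?_ (hv g)
  · rintro (_ | l)
    · exact mul_nonneg zero_le_three (sub_nonneg.2 (hz k))
    · exact sub_nonneg.2 (hk l)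
  · rintro (_ | l)
    · exact Or.inr (lor_down_sphere rfl)
    · rcases eq_or_ne k l with rfl | hkl
      · exact Or.inl (sub_self _)
      · exact Or.inr (lor_downCorner_sphere hi hkl rfl)
  · ext q
    have hcentre : pos (.inr ⟨i, hi⟩ : FinVert m) q = 3 * i q + 2 := rfl
    have hzq : z q = 3 * (i q + 1 - b q) := by
      simp only [hb]
      ring
    simp only [Fintype.sum_option, Option.elim, Finset.sum_apply, Pi.smul_apply,
      smul_eq_mul, hcentre, pos_downCorner, hzq, mul_sub _ _ (ite _ _ _), Finset.sum_sub_distrib,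
      ← Finset.sum_mul, hsum, mul_ite, mul_zero, Finset.sum_ite_eq, Finset.mem_univ, if_true,
      Finset.sum_const, Finset.card_univ, Fintype.card_fin]
    norm_num
    ring

lemma vec_mem_vertCone {z : Fin 3 → ℝ} {v : ℝ} (hz : ∀ k, 0 ≤ z k) (hs : level (m + 1) z = 1)
    (hv : ∀ g : Tri m, lor (vec (m + 1) z v) (wallVec (.inr g)) ≤ 0) :
    vec (m + 1) z v ∈ vertCone m := by
  have hsum : ∑ k, z k = 3 * (m + 1) := (div_eq_one_iff_eq (by positivity)).1 hs
  obtain ⟨i, hi, hup | hdown⟩ := exists_lattice_triangle (a := fun k => z k / 3) (m := m)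
    (fun k => div_nonneg (hz k) zero_le_three) (by rw [← Finset.sum_div, hsum]; ring)
  · exact vec_mem_vertCone_of_mem_upTriangle ⟨i, hup⟩ hsum (fun k => (hi k).1) (hv _)
  · exact vec_mem_vertCone_of_mem_downTriangle hdown hsum (fun k => (hi k).2) hv

lemma mem_vertCone {x : Fin 4 → ℝ} (hx : ∀ i : Wall m, lor x (wallVec i) ≤ 0) :
    x ∈ vertCone m := by
  obtain ⟨z, v, rfl⟩ := exists_eq_vec (Nat.cast_add_one_ne_zero m) x
  have hz (k) : 0 ≤ z k := by
    have := hx (.inl k)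
    rw [wallVec, lor_vec_sideNormal (Nat.cast_add_one_ne_zero m)] at this
    linarith
  have hlevel : 0 ≤ level (m + 1) z :=
    div_nonneg (Finset.sum_nonneg fun k _ => hz k) (by positivity)
  rcases hlevel.eq_or_lt with h0 | hpos
  · have hz0 : z = 0 := by
      rw [level, eq_comm, div_eq_zero_iff, or_iff_left (by positivity),
        Finset.sum_eq_zero_iff_of_nonneg fun k _ => hz k] at h0
      exact funext fun k => h0 k (Finset.mem_univ k)
    have hvec : vec (m + 1) z v = v • vertVec (m := m) none := by
      rw [vertVec, inftyPt, ← vec_smul, hz0, smul_zero, mul_one]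
    have hv := hx (.inr ⟨Pi.single 0 m, by simp⟩)
    rw [hvec, lor_smul_left, lor_infty_sphere] at hv
    exact hvec ▸ smul_mem_vertCone (vertVec_mem_vertCone _) (by linarith)
  · set u := level (m + 1) z
    have hscale : vec (m + 1) z v = u • vec (m + 1) (u⁻¹ • z) (u⁻¹ * v) := by
      rw [vec_smul, smul_smul, mul_inv_cancel₀ hpos.ne', one_smul]
    rw [hscale]
    refine smul_mem_vertCone (vec_mem_vertCone (fun k => ?_) ?_ fun g => ?_) hpos.le
    · exact mul_nonneg (inv_nonneg.2 hpos.le) (hz k)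
    · rw [level_smul, inv_mul_cancel₀ hpos.ne']
    · rw [vec_smul, lor_smul_left]
      exact mul_nonpos_of_nonneg_of_nonpos (inv_nonneg.2 hpos.le) (hx _)

/-- A vector over the centre of the triangle, high enough to lie above all hemispheres. -/
def triCenter (m : ℕ) : Fin 4 → ℝ := vec (m + 1) (fun _ => m + 1) (6 * (m + 1) ^ 2 + 7)

lemma level_const (m : ℕ) : level (m + 1) (fun _ => (m : ℝ) + 1) = 1 := by
  rw [level, div_eq_one_iff_eq (by positivity)]
  simp only [Finset.sum_const, Finset.card_univ, Fintype.card_fin, nsmul_eq_mul, Nat.cast_ofNat]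

lemma lor_triCenter_self_neg (m : ℕ) : lor (triCenter m) (triCenter m) < 0 := by
  rw [triCenter, lor_vec (Nat.cast_add_one_ne_zero m), level_const]
  simp only [dotProduct, Fin.sum_univ_three]
  nlinarith [sq_nonneg ((m : ℝ) + 1)]

lemma triCenter_zero_pos (m : ℕ) : 0 < triCenter m 0 := by
  simp only [triCenter, vec, level_const, Matrix.cons_val_zero]
  nlinarith [sq_nonneg ((m : ℝ) + 1)]

lemma lor_triCenter_wallVec_neg (i : Wall m) : lor (triCenter m) (wallVec i) < 0 := by
  rcases i with i | g
  · rw [triCenter, wallVec, lor_vec_sideNormal (Nat.cast_add_one_ne_zero m)]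
    exact neg_neg_of_pos (by positivity)
  · rw [triCenter, wallVec,
      lor_vec_sphereNormal (Nat.cast_add_one_ne_zero m) _ _ (level_ctr g), level_const]
    have hdot : (fun _ => (m : ℝ) + 1) ⬝ᵥ ctr g = 3 * (m + 1) ^ 2 := by
      have hsum : ∑ i, ctr g i = 3 * (m + 1) := (div_eq_one_iff_eq (by positivity)).1 (level_ctr g)
      rw [dotProduct, ← Finset.mul_sum, hsum]
      ring
    have hnonneg : 0 ≤ ctr g ⬝ᵥ ctr g := Finset.sum_nonneg fun _ _ => mul_self_nonneg _
    rw [hdot]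
    linarith

/-- The cone over the ideal polyhedron whose vertical sides bound a triangle of side `m + 1`. -/
def triCone (m : ℕ) : IdealCone (Wall m) (Vert m) where
  normal := wallVec
  gen := vertVec
  center := triCenter m
  lor_normal_self := lor_wallVec_self
  lor_gen_self := lor_vertVec_self
  gen_zero_pos := vertVec_zero_pos
  lor_gen_gen_neg := lor_vertVec_vertVec_neg
  lor_gen_normal_nonpos := lor_vertVec_wallVec_nonpos
  exists_combination x hx := by
    obtain ⟨c, hc⟩ := (Submodule.mem_span_range_iff_exists_fun NNReal).1 (mem_vertCone hx)
    exact ⟨fun j => c j, fun j => (c j).2, hc.symm⟩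
  lor_center_self_neg := lor_triCenter_self_neg m
  center_zero_pos := triCenter_zero_pos m
  lor_center_normal_neg := lor_triCenter_wallVec_neg
  two_lt_ncard := two_lt_ncard_vert_on_wall
  lor_normal_normal := lor_wallVec_angle

/-! ### The adjacency graph -/

lemma mem_neighbours_triCone {i i' : Wall m} :
    i' ∈ (triCone m).neighbours i ↔ lor (wallVec i) (wallVec i') = -1 / 2 :=
  Iff.rfl

lemma side_mem_neighbours_side {i i' : Fin 3} :
    .inl i' ∈ (triCone m).neighbours (.inl i) ↔ i ≠ i' := by
  rw [mem_neighbours_triCone, lor_side_side]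
  split_ifs with h
  · simp only [h, ne_eq, not_true_eq_false, iff_false]
    norm_num
  · simpa using Ne.symm h

lemma side_mem_neighbours_sphere {g : Tri m} {i : Fin 3} :
    .inl i ∈ (triCone m).neighbours (.inr g) ↔ g.1 i = 0 := by
  rw [mem_neighbours_triCone, lor_sphere_side, ← Nat.cast_eq_zero (R := ℝ)]
  constructor <;> intro h <;> linarith

lemma sphere_mem_neighbours_side {g : Tri m} {i : Fin 3} :
    .inr g ∈ (triCone m).neighbours (.inl i) ↔ g.1 i = 0 := by
  rw [← side_mem_neighbours_sphere, mem_neighbours_triCone, mem_neighbours_triCone, lor_comm]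

lemma sphere_mem_neighbours_sphere {g g' : Tri m} :
    .inr g' ∈ (triCone m).neighbours (.inr g) ↔ sqDist g.1 g'.1 = 2 := by
  rw [mem_neighbours_triCone, lor_sphere_sphere, ← Int.cast_inj (α := ℝ), Int.cast_ofNat]
  constructor <;> intro h <;> linarith

/-- The possible steps from `g`: a unit moved from the second to the first coordinate of the
pair. -/
abbrev StepLabel (g : Tri m) : Type := {p : Fin 3 × Fin 3 // p.1 ≠ p.2 ∧ g.1 p.2 ≠ 0}

lemma exists_eq_add_single_and_add_sub_single_eq {f : Fin 3 → ℕ} (k : Fin 3) {l : Fin 3}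
    (h : f l ≠ 0) : ∃ w : Fin 3 → ℕ,
      f = w + Pi.single l 1 ∧ f + Pi.single k 1 - Pi.single l 1 = w + Pi.single k 1 := by
  obtain ⟨w, rfl⟩ := exists_eq_add_single h
  exact ⟨w, rfl, by rw [add_right_comm, add_tsub_cancel_right]⟩

/-- The lattice point reached from `g` by a step. -/
def step (g : Tri m) (p : StepLabel g) : Tri m :=
  ⟨g.1 + Pi.single p.1.1 1 - Pi.single p.1.2 1, by
    obtain ⟨w, hg, hstep⟩ := exists_eq_add_single_and_add_sub_single_eq p.1.1 p.2.2
    rw [hstep, sum_add_single, ← sum_add_single w p.1.2, ← hg, g.2]⟩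

lemma exists_step_eq (g : Tri m) (p : StepLabel g) : ∃ w : Fin 3 → ℕ,
    g.1 = w + Pi.single p.1.2 1 ∧ (step g p).1 = w + Pi.single p.1.1 1 :=
  exists_eq_add_single_and_add_sub_single_eq p.1.1 p.2.2

lemma step_injective (g : Tri m) : Function.Injective (step g) := by
  have single_add_single : ∀ k l k' l' : Fin 3, k ≠ l → k' ≠ l' →
      (Pi.single k 1 + Pi.single l' 1 : Fin 3 → ℕ) = Pi.single k' 1 + Pi.single l 1 →
      (k, l) = (k', l') := by decide
  intro p q h
  obtain ⟨w, hw, hp⟩ := exists_step_eq g p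
  obtain ⟨w', hw', hq⟩ := exists_step_eq g q
  refine Subtype.ext (single_add_single p.1.1 p.1.2 q.1.1 q.1.2 p.2.1 q.2.1 ?_)
  have htarget := hp.symm.trans ((congrArg Subtype.val h).trans hq)
  have hsource := hw.symm.trans hw'
  funext i
  have h1 := congrFun htarget i
  have h2 := congrFun hsource i
  simp only [Pi.add_apply] at h1 h2 ⊢
  omega

lemma sqDist_eq_two_iff_mem_range_step {g g' : Tri m} :
    sqDist g.1 g'.1 = 2 ↔ g' ∈ Set.range (step g) := by
  constructor
  · intro h
    have hne : g.1 ≠ g'.1 := fun e => by simp [e, sqDist_self] at h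
    obtain h4 | ⟨w, l, k, hlk, hg, hg'⟩ :=
      four_le_sqDist_or_exists_eq hne (g.2.trans g'.2.symm)
    · omega
    · let p : StepLabel g := ⟨(k, l), hlk.symm, by simp [hg]⟩
      obtain ⟨w', hw', hstep⟩ := exists_step_eq g p
      obtain rfl : w = w' := add_right_cancel (hg.symm.trans hw')
      exact ⟨p, Subtype.ext (hstep.trans hg'.symm)⟩
  · rintro ⟨p, rfl⟩
    obtain ⟨w, hg, hstep⟩ := exists_step_eq g p
    have hdist := sqDist_add_single_add_single w p.2.1.symm
    rwa [← hg, ← hstep] at hdist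

/-- The number of sides of the triangle on which `g` lies. -/
def zeroCount (g : Tri m) : ℕ := (Finset.univ.filter fun i => g.1 i = 0).card

lemma natCard_stepLabel (g : Tri m) : Nat.card (StepLabel g) = 2 * (3 - zeroCount g) := by
  have card_pairs : ∀ Z : Fin 3 → Bool,
      (Finset.univ.filter fun p : Fin 3 × Fin 3 => p.1 ≠ p.2 ∧ Z p.2 ≠ true).card =
        2 * (3 - (Finset.univ.filter fun i => Z i = true).card) := by decide
  simpa [zeroCount, StepLabel, Fintype.card_subtype] using card_pairs fun i => decide (g.1 i = 0)

lemma neighbours_sphere (g : Tri m) : (triCone m).neighbours (.inr g) =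
    Sum.inl '' {i | g.1 i = 0} ∪ Sum.inr '' Set.range (step g) := by
  ext (i | g')
  · simp [side_mem_neighbours_sphere]
  · simp [sphere_mem_neighbours_sphere, sqDist_eq_two_iff_mem_range_step]

lemma encard_neighbours_sphere (g : Tri m) :
    ((triCone m).neighbours (.inr g)).encard = (6 - zeroCount g : ℕ) := by
  have hzero : zeroCount g ≤ 3 := (Finset.card_filter_le _ _).trans (by simp)
  have hsides : {i | g.1 i = 0}.encard = zeroCount g := by
    rw [zeroCount, ← Set.encard_coe_eq_coe_finsetCard]
    simp
  rw [neighbours_sphere, Set.encard_union_eq Set.disjoint_image_inl_image_inr,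
    Sum.inl_injective.encard_image, Sum.inr_injective.encard_image, hsides, ← Set.image_univ,
    (step_injective g).encard_image, Set.encard_univ, ENat.card_eq_coe_natCard, natCard_stepLabel]
  norm_cast
  omega

lemma sum_eq_cyclic (f : Fin 3 → ℕ) (i : Fin 3) : ∑ l, f l = f i + f (i + 1) + f (i + 2) := by
  fin_cases i <;> simp [Fin.sum_univ_three] <;> omega

lemma eq_or_eq_add_one_or_eq_add_two : ∀ l i : Fin 3, l = i ∨ l = i + 1 ∨ l = i + 2 := by
  decide

lemma injOn_apply_add_one (i : Fin 3) :
    Set.InjOn (fun g : Tri m => g.1 (i + 1)) {g | g.1 i = 0} := by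
  intro g (hg : g.1 i = 0) g' (hg' : g'.1 i = 0) (h : g.1 (i + 1) = g'.1 (i + 1))
  have hs := g.2
  have hs' := g'.2
  rw [sum_eq_cyclic _ i] at hs hs'
  refine Subtype.ext (funext fun l => ?_)
  obtain rfl | rfl | rfl := eq_or_eq_add_one_or_eq_add_two l i <;> omega

lemma exists_side_apply_add_one_eq (i : Fin 3) {t : ℕ} (ht : t ≤ m) :
    ∃ g : Tri m, g.1 i = 0 ∧ g.1 (i + 1) = t := by
  refine ⟨⟨Pi.single (i + 1) t + Pi.single (i + 2) (m - t), ?_⟩, ?_, ?_⟩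
  · rw [sum_add_single]
    simp [ht]
  all_goals fin_cases i <;> simp

lemma encard_side (i : Fin 3) : {g : Tri m | g.1 i = 0}.encard = (m + 1 : ℕ) := by
  have himage : (fun g : Tri m => g.1 (i + 1)) '' {g | g.1 i = 0} = Finset.range (m + 1) := by
    ext t
    simp only [Finset.coe_range, Set.mem_Iio, Nat.lt_succ_iff]
    constructor
    · rintro ⟨g, -, rfl⟩
      exact (Finset.single_le_sum (fun _ _ => Nat.zero_le _) (Finset.mem_univ _)).trans g.2.le
    · exact fun ht => exists_side_apply_add_one_eq i ht
  rw [← (injOn_apply_add_one i).encard_image, himage, Set.encard_coe_eq_coe_finsetCard,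
    Finset.card_range]

lemma neighbours_side (i : Fin 3) : (triCone m).neighbours (.inl i) =
    Sum.inl '' {i}ᶜ ∪ Sum.inr '' {g : Tri m | g.1 i = 0} := by
  ext (i' | g)
  · simp [side_mem_neighbours_side, eq_comm]
  · simp [sphere_mem_neighbours_side]

lemma encard_neighbours_side (i : Fin 3) :
    ((triCone m).neighbours (.inl i)).encard = (m + 1 + 2 : ℕ) := by
  have hcompl : ({i}ᶜ : Set (Fin 3)).encard = 2 := by
    rw [← Finset.coe_singleton, ← Finset.coe_compl, Set.encard_coe_eq_coe_finsetCard,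
      Finset.card_compl]
    simp
  rw [neighbours_side, Set.encard_union_eq Set.disjoint_image_inl_image_inr,
    Sum.inl_injective.encard_image, Sum.inr_injective.encard_image, hcompl, encard_side, add_comm]
  norm_cast

/-! ### Counting -/

lemma card_tri (k : ℕ) : Nat.card (Tri k) * 2 = (k + 1) * (k + 2) := by
  rw [← Nat.card_congr (Sym.equivNatSumOfFintype (Fin 3) k), Nat.card_eq_fintype_card,
    Sym.card_sym_eq_choose, Fintype.card_fin, show 3 + k - 1 = k + 2 by omega,
    Nat.choose_symm_add, Nat.choose_two_right,
    Nat.div_mul_cancel (Nat.even_mul_pred_self _).two_dvd]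
  exact mul_comm _ _

lemma card_wall (m : ℕ) : Nat.card (Wall m) = ((m + 1) ^ 2 + (m + 1) + 6) / 2 := by
  have h := card_tri m
  rw [Nat.card_sum, Nat.card_eq_fintype_card, Fintype.card_fin]
  ring_nf at h ⊢
  omega

lemma card_downTri (k : ℕ) : Nat.card (DownTri k) * 2 = k * (k + 1) := by
  obtain _ | k := k
  · have : IsEmpty (DownTri 0) := ⟨fun f => Nat.succ_ne_zero _ f.2⟩
    simp
  · rw [← card_tri k]
    exact congrArg (· * 2) (Nat.card_congr (Equiv.subtypeEquivRight fun f => Nat.succ_inj))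

lemma card_vert (m : ℕ) : Nat.card (Vert m) = (m + 1) ^ 2 + (m + 1) + 2 := by
  have htri := card_tri (m + 1)
  have hdown := card_downTri m
  rw [Finite.card_option, Nat.card_sum]
  ring_nf at htri hdown ⊢
  omega

/-- The interior lattice points are obtained from a triangle of size `k` by adding `1` to every
coordinate. -/
lemma encard_interior_add_three (k : ℕ) :
    {g : Tri (k + 3) | ∀ i, g.1 i ≠ 0}.encard = Nat.card (Tri k) := by
  let shift : Tri k → Tri (k + 3) := fun f => ⟨f.1 + 1, by simp [Finset.sum_add_distrib, f.2]⟩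
  have hinj : Function.Injective shift := fun f f' h =>
    Subtype.ext (add_right_cancel (congrArg Subtype.val h))
  have hrange : {g : Tri (k + 3) | ∀ i, g.1 i ≠ 0} = Set.range shift := by
    ext g
    constructor
    · intro hg
      have hsub : g.1 - 1 + 1 = g.1 :=
        tsub_add_cancel_of_le fun i => Nat.one_le_iff_ne_zero.2 (hg i)
      refine ⟨⟨g.1 - 1, ?_⟩, Subtype.ext hsub⟩
      have hsum := g.2
      rw [← hsub] at hsum
      simpa [Finset.sum_add_distrib] using hsum
    · rintro ⟨f, rfl⟩ i
      exact Nat.succ_ne_zero _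
  rw [hrange, ← Set.image_univ, hinj.encard_image, Set.encard_univ, ENat.card_eq_coe_natCard]

lemma encard_interior (m : ℕ) :
    {g : Tri m | ∀ i, g.1 i ≠ 0}.encard = ((m + 1 - 3) * (m + 1 - 2) / 2 : ℕ) := by
  obtain hm | hm := lt_or_ge m 3
  · have hempty : {g : Tri m | ∀ i, g.1 i ≠ 0} = ∅ := by
      refine Set.eq_empty_of_forall_notMem fun g hg => ?_
      have hsum := g.2
      rw [Fin.sum_univ_three] at hsum
      have := hg 0
      have := hg 1
      have := hg 2
      omega
    simp [hempty, show m + 1 - 3 = 0 by omega]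
  · obtain ⟨k, rfl⟩ := Nat.exists_eq_add_of_le' hm
    rw [encard_interior_add_three, show k + 3 + 1 - 3 = k + 1 by omega,
      show k + 3 + 1 - 2 = k + 2 by omega, ← card_tri, Nat.mul_div_cancel _ two_pos]

/-- The lattice point in the `k`-th corner. -/
def cornerTri (m : ℕ) (k : Fin 3) : Tri m := ⟨Pi.single k m, by simp⟩

lemma cornerTri_apply_eq_zero {i k : Fin 3} (h : i ≠ k) : (cornerTri m k).1 i = 0 := by
  simp [cornerTri, h]

lemma cornerTri_apply_self (k : Fin 3) : (cornerTri m k).1 k = m := by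
  simp [cornerTri]

lemma eq_cornerTri {g : Tri m} {k : Fin 3} (h : ∀ l ≠ k, g.1 l = 0) : g = cornerTri m k := by
  have hk : g.1 k = m :=
    (Finset.sum_eq_single k (fun l _ => h l) (by simp)).symm.trans g.2
  refine Subtype.ext (funext fun l => ?_)
  obtain rfl | hl := eq_or_ne l k
  · rw [hk, cornerTri_apply_self]
  · rw [h l hl, cornerTri_apply_eq_zero hl]

lemma cornerTri_injective (hm : m ≠ 0) : Function.Injective (cornerTri m) := by
  intro k l h
  by_contra hkl
  exact hm (by rw [← cornerTri_apply_self (m := m) k, h, cornerTri_apply_eq_zero hkl])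

lemma eq_zero_iff_of_ne_cornerTri {g : Tri m} {i : Fin 3} (h : g.1 i = 0)
    (hc : ∀ k, g ≠ cornerTri m k) (l : Fin 3) : g.1 l = 0 ↔ l = i := by
  refine ⟨fun hl => ?_, fun hl => hl ▸ h⟩
  by_contra hne
  have hthird : ∀ i l : Fin 3, l ≠ i → ∃ k, ∀ j ≠ k, j = i ∨ j = l := by decide
  obtain ⟨k, hk⟩ := hthird i l hne
  exact hc k (eq_cornerTri fun j hj => (hk j hj).elim (· ▸ h) (· ▸ hl))

lemma ne_cornerTri_of_eq_zero_iff {g : Tri m} {i : Fin 3} (h : ∀ l, g.1 l = 0 ↔ l = i)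
    (k : Fin 3) : g ≠ cornerTri m k := by
  rintro rfl
  have htwo : ∀ k i : Fin 3, ∃ l ≠ k, l ≠ i := by decide
  obtain ⟨l, hlk, hli⟩ := htwo k i
  exact hli ((h l).1 (cornerTri_apply_eq_zero hlk))

lemma zeroCount_cornerTri (hm : m ≠ 0) (k : Fin 3) : zeroCount (cornerTri m k) = 2 := by
  have hzeros : (Finset.univ.filter fun i => (cornerTri m k).1 i = 0) = {k}ᶜ := by
    ext i
    simp [cornerTri, Pi.single_apply, hm]
  rw [zeroCount, hzeros, Finset.card_compl]
  simp

lemma zeroCount_eq_one {g : Tri m} {i : Fin 3} (h : ∀ l, g.1 l = 0 ↔ l = i) :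
    zeroCount g = 1 := by
  simp [zeroCount, h, Finset.filter_eq']

lemma zeroCount_eq_zero {g : Tri m} (h : ∀ i, g.1 i ≠ 0) : zeroCount g = 0 := by
  simp [zeroCount, h]

lemma encard_openSide (i : Fin 3) :
    {g : Tri m | ∀ l, g.1 l = 0 ↔ l = i}.encard = (m - 1 : ℕ) := by
  have hsub : {g : Tri m | ∀ l, g.1 l = 0 ↔ l = i} ⊆ {g | g.1 i = 0} := fun g hg => (hg i).2 rfl
  have himage : (fun g : Tri m => g.1 (i + 1)) '' {g | ∀ l, g.1 l = 0 ↔ l = i} =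
      Finset.Ioo 0 m := by
    have hne : ∀ i : Fin 3, i + 1 ≠ i ∧ i + 2 ≠ i := by decide
    ext t
    rw [Finset.coe_Ioo, Set.mem_Ioo]
    constructor
    · rintro ⟨g, hg, rfl⟩
      have hsum := g.2
      rw [sum_eq_cyclic _ i] at hsum
      have h1 := (hg (i + 1)).not.2 (hne i).1
      have h2 := (hg (i + 2)).not.2 (hne i).2
      dsimp only
      omega
    · rintro ⟨ht0, htm⟩
      obtain ⟨g, h0, rfl⟩ := exists_side_apply_add_one_eq i htm.le
      have hsum := g.2
      rw [sum_eq_cyclic _ i] at hsum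
      refine ⟨g, fun l => ⟨fun hl => ?_, fun hl => hl ▸ h0⟩, rfl⟩
      obtain rfl | rfl | rfl := eq_or_eq_add_one_or_eq_add_two l i <;> first | rfl | omega
  rw [← ((injOn_apply_add_one i).mono hsub).encard_image, himage,
    Set.encard_coe_eq_coe_finsetCard, Nat.card_Ioo, Nat.sub_zero]

lemma encard_sides (m : ℕ) :
    {g : Tri m | (∀ k, g ≠ cornerTri m k) ∧ ∃ i, g.1 i = 0}.encard = (3 * (m + 1 - 2) : ℕ) := by
  have hunion : {g : Tri m | (∀ k, g ≠ cornerTri m k) ∧ ∃ i, g.1 i = 0} =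
      ⋃ i, {g | ∀ l, g.1 l = 0 ↔ l = i} := by
    ext g
    rw [Set.mem_iUnion]
    exact ⟨fun ⟨hc, i, hi⟩ => ⟨i, eq_zero_iff_of_ne_cornerTri hi hc⟩,
      fun ⟨i, hi⟩ => ⟨ne_cornerTri_of_eq_zero_iff hi, i, (hi i).2 rfl⟩⟩
  have hdisj : Pairwise (Function.onFun Disjoint
      fun i : Fin 3 => {g : Tri m | ∀ l, g.1 l = 0 ↔ l = i}) := fun i i' hne =>
    Set.disjoint_left.2 fun g hg hg' => hne ((hg' i).1 ((hg i).2 rfl))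
  rw [hunion, Set.encard_iUnion_of_finite hdisj, finsum_eq_sum_of_fintype]
  simp [encard_openSide]

/-! ### The polyhedra -/

/-- The polyhedron `P_n` of the theorem, for `n = m + 1`. -/
def triPoly (m : ℕ) : Set H3 := (triCone m).poly

/-- The faces `A_i`, on the vertical planes. -/
def sideFace (m : ℕ) (i : Fin 3) : Set H3 := (triCone m).face (.inl i)

/-- The face on the hemisphere about the lattice point `g`. -/
def sphereFace (g : Tri m) : Set H3 := (triCone m).face (.inr g)

/-- The faces `B_i`, at the corner where the sides `i` and `i + 1` meet. -/
def cornerFace (m : ℕ) (i : Fin 3) : Set H3 := sphereFace (cornerTri m (i + 2))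

lemma sideFace_injective (m : ℕ) : Function.Injective (sideFace m) :=
  (triCone m).face_injective.comp Sum.inl_injective

lemma sphereFace_injective : Function.Injective (sphereFace (m := m)) :=
  (triCone m).face_injective.comp Sum.inr_injective

lemma sphereFace_ne_sideFace (g : Tri m) (i : Fin 3) : sphereFace g ≠ sideFace m i :=
  (triCone m).face_injective.ne Sum.inr_ne_inl

lemma sphereFace_notMem_range_sideFace (g : Tri m) :
    sphereFace g ∉ Set.range (sideFace m) :=
  fun ⟨i, hi⟩ => sphereFace_ne_sideFace g i hi.symm

lemma sphereFace_notMem_range_cornerFace {g : Tri m} :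
    sphereFace g ∉ Set.range (cornerFace m) ↔ ∀ k, g ≠ cornerTri m k := by
  have hsurj : ∀ k : Fin 3, ∃ i, i + 2 = k := by decide
  constructor
  · rintro h k rfl
    obtain ⟨i, rfl⟩ := hsurj k
    exact h ⟨i, rfl⟩
  · rintro h ⟨i, hi⟩
    exact h _ (sphereFace_injective hi).symm

lemma mem_faces_triPoly {F : Set H3} :
    F ∈ faces (triPoly m) ↔ (∃ i, sideFace m i = F) ∨ ∃ g : Tri m, sphereFace g = F := by
  rw [triPoly, (triCone m).faces_poly]
  exact Sum.exists

lemma adjacent_sideFace_sideFace {i i' : Fin 3} :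
    Adjacent (triPoly m) (sideFace m i) (sideFace m i') ↔ i ≠ i' :=
  (triCone m).adjacent_iff.trans side_mem_neighbours_side

lemma adjacent_sphereFace_sideFace {g : Tri m} {i : Fin 3} :
    Adjacent (triPoly m) (sphereFace g) (sideFace m i) ↔ g.1 i = 0 :=
  (triCone m).adjacent_iff.trans side_mem_neighbours_sphere

lemma isGon_sideFace (m : ℕ) (i : Fin 3) : IsGon (triPoly m) (m + 1 + 2) (sideFace m i) :=
  (triCone m).isGon_iff.2 (encard_neighbours_side i)

lemma isGon_sphereFace (g : Tri m) : IsGon (triPoly m) (6 - zeroCount g) (sphereFace g) :=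
  (triCone m).isGon_iff.2 (encard_neighbours_sphere g)

lemma faces_at_infty (m : ℕ) :
    {F | F ∈ faces (triPoly m) ∧ (triCone m).point none ∈ pointsAtInfinity F} =
      Set.range (sideFace m) := by
  ext F
  rw [Set.mem_ofPred_eq, mem_faces_triPoly]
  constructor
  · rintro ⟨hside | ⟨g, rfl⟩, hinfty⟩
    · exact hside
    · have hlor : lor (vertVec none) (wallVec (.inr g)) = 0 :=
        ((triCone m).point_mem_pointsAtInfinity_face (.inr g) none).1 hinfty
      rw [lor_infty_sphere] at hlor
      norm_num at hlor
  · rintro ⟨i, rfl⟩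
    exact ⟨.inl ⟨i, rfl⟩,
      ((triCone m).point_mem_pointsAtInfinity_face (.inl i) none).2 (lor_infty_side i)⟩

lemma common_neighbours_of_sideFace (i : Fin 3) :
    {F | Adjacent (triPoly m) F (sideFace m i) ∧ Adjacent (triPoly m) F (sideFace m (i + 1)) ∧
      F ≠ sideFace m (i + 2)} = {cornerFace m i} := by
  have eq_add_two : ∀ k i : Fin 3, k ≠ i → k ≠ i + 1 → k = i + 2 := by decide
  have ne_add_two : ∀ i : Fin 3, i ≠ i + 2 ∧ i + 1 ≠ i + 2 := by decide
  ext F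
  constructor
  · rintro ⟨h, h', hne⟩
    obtain ⟨k, rfl⟩ | ⟨g, rfl⟩ := mem_faces_triPoly.1 h.1
    · rw [adjacent_sideFace_sideFace] at h h'
      exact absurd (congrArg (sideFace m) (eq_add_two k i h h')) hne
    · rw [adjacent_sphereFace_sideFace] at h h'
      refine congrArg sphereFace (eq_cornerTri fun l hl => ?_)
      obtain rfl | rfl | rfl := eq_or_eq_add_one_or_eq_add_two l i
      exacts [h, h', absurd rfl hl]
  · rintro rfl
    exact ⟨adjacent_sphereFace_sideFace.2 (cornerTri_apply_eq_zero (ne_add_two i).1),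
      adjacent_sphereFace_sideFace.2 (cornerTri_apply_eq_zero (ne_add_two i).2),
      sphereFace_ne_sideFace _ _⟩

lemma cornerFace_zero (i : Fin 3) :
    cornerFace 0 i = cornerFace 0 0 ∧ IsGon (triPoly 0) 3 (cornerFace 0 i) := by
  have hzero : ∀ k l, (cornerTri 0 k).1 l = 0 := by simp [cornerTri]
  refine ⟨congrArg sphereFace (eq_cornerTri fun l _ => hzero _ l), ?_⟩
  have hcount : zeroCount (cornerTri 0 (i + 2)) = 3 := by simp [zeroCount, hzero]
  have hgon := isGon_sphereFace (cornerTri 0 (i + 2))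
  rwa [hcount] at hgon

lemma cornerFace_injective (hm : m ≠ 0) : Function.Injective (cornerFace m) :=
  sphereFace_injective.comp ((cornerTri_injective hm).comp (add_left_injective 2))

lemma isGon_cornerFace (hm : m ≠ 0) (i : Fin 3) : IsGon (triPoly m) 4 (cornerFace m i) := by
  have hgon := isGon_sphereFace (cornerTri m (i + 2))
  rwa [zeroCount_cornerTri hm] at hgon

lemma isGon_of_adjacent_sideFace {F : Set H3} (hF : F ∈ faces (triPoly m))
    (hside : F ∉ Set.range (sideFace m)) (hcorner : F ∉ Set.range (cornerFace m))
    (hadj : ∃ i, Adjacent (triPoly m) F (sideFace m i)) :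
    (∃! i, Adjacent (triPoly m) F (sideFace m i)) ∧ IsGon (triPoly m) 5 F := by
  obtain ⟨g, rfl⟩ := (mem_faces_triPoly.1 hF).resolve_left hside
  obtain ⟨i, hi⟩ := hadj
  have hzeros := eq_zero_iff_of_ne_cornerTri (adjacent_sphereFace_sideFace.1 hi)
    (sphereFace_notMem_range_cornerFace.1 hcorner)
  have hgon := isGon_sphereFace g
  rw [zeroCount_eq_one hzeros] at hgon
  exact ⟨⟨i, hi, fun l hl => (hzeros l).1 (adjacent_sphereFace_sideFace.1 hl)⟩, hgon⟩

lemma isGon_of_not_adjacent_sideFace {F : Set H3} (hF : F ∈ faces (triPoly m))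
    (hside : F ∉ Set.range (sideFace m))
    (hadj : ∀ i, ¬ Adjacent (triPoly m) F (sideFace m i)) : IsGon (triPoly m) 6 F := by
  obtain ⟨g, rfl⟩ := (mem_faces_triPoly.1 hF).resolve_left hside
  have hgon := isGon_sphereFace g
  rwa [zeroCount_eq_zero fun i => adjacent_sphereFace_sideFace.not.1 (hadj i)] at hgon

lemma encard_faces_not_side (p : Set H3 → Prop) :
    {F | F ∈ faces (triPoly m) ∧ F ∉ Set.range (sideFace m) ∧ p F}.encard =
      {g : Tri m | p (sphereFace g)}.encard := by
  rw [← sphereFace_injective.encard_image]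
  congr 1
  ext F
  constructor
  · rintro ⟨hF, hside, hp⟩
    obtain ⟨g, rfl⟩ := (mem_faces_triPoly.1 hF).resolve_left hside
    exact ⟨g, hp, rfl⟩
  · rintro ⟨g, hp, rfl⟩
    exact ⟨mem_faces_triPoly.2 (.inr ⟨g, rfl⟩), sphereFace_notMem_range_sideFace g, hp⟩

lemma encard_faces_adjacent_side (m : ℕ) :
    {F | F ∈ faces (triPoly m) ∧ F ∉ Set.range (sideFace m) ∧ F ∉ Set.range (cornerFace m) ∧
      ∃ i, Adjacent (triPoly m) F (sideFace m i)}.encard = (3 * (m + 1 - 2) : ℕ) := by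
  rw [encard_faces_not_side, ← encard_sides]
  simp only [sphereFace_notMem_range_cornerFace, adjacent_sphereFace_sideFace]

lemma encard_faces_not_adjacent_side (m : ℕ) :
    {F | F ∈ faces (triPoly m) ∧ F ∉ Set.range (sideFace m) ∧
      ∀ i, ¬ Adjacent (triPoly m) F (sideFace m i)}.encard =
      ((m + 1 - 3) * (m + 1 - 2) / 2 : ℕ) := by
  rw [encard_faces_not_side, ← encard_interior]
  simp only [adjacent_sphereFace_sideFace, ne_eq]

theorem hasStructure_triPoly (m : ℕ) : HasStructure (m + 1) (triPoly m) := by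
  have hinfty : (triCone m).point none ∈ idealVertices (triPoly m) := by
    rw [triPoly, (triCone m).idealVertices_poly]
    exact ⟨none, rfl⟩
  refine ⟨(triCone m).point none, hinfty, sideFace m, cornerFace m, sideFace_injective m,
    faces_at_infty m, fun i j => adjacent_sideFace_sideFace.2, isGon_sideFace m,
    common_neighbours_of_sideFace, fun hm => ?_, fun hm => ?_,
    fun F => isGon_of_adjacent_sideFace, fun F => isGon_of_not_adjacent_sideFace,
    fun _ => ⟨encard_faces_adjacent_side m, encard_faces_not_adjacent_side m⟩⟩
  · obtain rfl : m = 0 := by omega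
    exact cornerFace_zero
  · have hm0 : m ≠ 0 := by omega
    exact ⟨cornerFace_injective hm0, isGon_cornerFace hm0⟩

lemma encard_faces_triPoly (m : ℕ) :
    (faces (triPoly m)).encard = (((m + 1) ^ 2 + (m + 1) + 6) / 2 : ℕ) := by
  rw [triPoly, (triCone m).faces_poly, ← Set.image_univ, (triCone m).face_injective.encard_image,
    Set.encard_univ, ENat.card_eq_coe_natCard, card_wall]

lemma encard_idealVertices_triPoly (m : ℕ) :
    (idealVertices (triPoly m)).encard = ((m + 1) ^ 2 + (m + 1) + 2 : ℕ) := by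
  rw [triPoly, (triCone m).idealVertices_poly, ← Set.image_univ,
    (triCone m).point_injective.encard_image, Set.encard_univ, ENat.card_eq_coe_natCard, card_vert]

lemma triPoly_class_injective :
    Function.Injective fun m => Quotient.mk congruence (triPoly m) := by
  have hmono : StrictMono fun m => Nat.card (Tri m) := by
    refine strictMono_nat_of_lt_succ fun m => ?_
    have hm := card_tri m
    have hsucc := card_tri (m + 1)
    nlinarith
  intro m m' h
  have hfaces := (Quotient.exact h : Congruent (triPoly m) (triPoly m')).encard_faces_eq
  rw [encard_faces_triPoly, encard_faces_triPoly, ← card_wall, ← card_wall, Nat.card_sum,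
    Nat.card_sum, Nat.cast_inj, Nat.add_left_cancel_iff] at hfaces
  exact hmono.injective hfaces

end

end Hyp

theorem mainTheorem2 :
    (∀ n : ℕ, 1 ≤ n → ∃ P : Set Hyp.H3,
      Hyp.IsIdealPolyhedron P ∧ Hyp.IsEquiangular (Real.pi / 3) P ∧
      Hyp.HasStructure n P ∧
      (Hyp.faces P).encard = ((n ^ 2 + n + 6) / 2 : ℕ) ∧
      (Hyp.idealVertices P).encard = (n ^ 2 + n + 2 : ℕ)) ∧
    {c : Quotient Hyp.congruence | ∃ P : Set Hyp.H3,
      Hyp.IsEquiangular (Real.pi / 3) P ∧ Quotient.mk Hyp.congruence P = c}.Infinite := by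
  constructor
  · intro n hn
    obtain ⟨m, rfl⟩ := Nat.exists_eq_add_of_le' hn
    exact ⟨Hyp.triPoly m, (Hyp.triCone m).isIdealPolyhedron, (Hyp.triCone m).isEquiangular,
      Hyp.hasStructure_triPoly m, Hyp.encard_faces_triPoly m, Hyp.encard_idealVertices_triPoly m⟩
  · refine (Set.infinite_range_of_injective Hyp.triPoly_class_injective).mono ?_
    rintro _ ⟨m, rfl⟩
    exact ⟨Hyp.triPoly m, (Hyp.triCone m).isEquiangular, rfl⟩
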